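/- Let $\Lambda=\mathbb{Z}[z,c_1,c_2,\dots]$, with $c_0=1$. For integers $p,q\ge 0$ put $$\mathrm{Pf}_{p,q}=\sum_{0\le i\le j\le q}(-1)^j\Big(\tbinom{j}{i}+\tbinom{j-1}{i}\Big)z^i\,c_{p+j-i}\,c_{q-j},\qquad \tbinom{-1}{i}=0,$$ and let $\mathbf{\Gamma}=\Lambda/(\mathrm{Pf}_{1,1},\mathrm{Pf}_{2,2},\mathrm{Pf}_{3,3},\dots)$. For a strict partition $\lambda=(\lambda_1>\dots>\lambda_n>0)$ let $Q_\lambda=\mathrm{Pf}_{\lambda}\in\mathbf{\Gamma}$, where $\mathrm{Pf}_\emptyset=1$ and, inductively, $$\mathrm{Pf}_\lambda=\sum_{k=1}^n(-1)^{k-1}c_{\lambda_k}\,\mathrm{Pf}_{\lambda_1,\dots,\widehat{\lambda_k},\dots,\lambda_n}\ (n\text{ odd}),\qquad \mathrm{Pf}_\lambda=\sum_{k=2}^n(-1)^{k}\,\mathrm{Pf}_{\lambda_1,\lambda_k}\,\mathrm{Pf}_{\lambda_2,\dots,\widehat{\lambda_k},\dots,\lambda_n}\ (n>0\text{ even, the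 first factor being the two-index sum above}).$$ On $\mathbf{\Gamma}[x,y]=\mathbf{\Gamma}[x_1,x_2,\dots,y_1,y_2,\dots]$ let $s_0$ be the ring endomorphism that fixes $z$, all $y_i$, and $x_i$ for $i\ge2$, and that satisfies $s_0(x_1)=z-x_1$ and $s_0(c_k)=c_k+(2x_1-z)\sum_{i+j=k-1}(x_1-z)^i c_j$. Let $\partial_0$ be the difference operator $$\partial_0(f)=\frac{f-s_0(f)}{z-2x_1};$$ explicitly, $\partial_0$ is the additive operator with $\partial_0(fg)=f\,\partial_0(g)+g\,\partial_0(f)-(z-2x_1)\,\partial_0(f)\,\partial_0(g)$, which vanishes on $z$, on all $y_i$ and on $x_i$ for $i\ge 2$, and has $\partial_0(x_1)=-1$ and $\partial_0(c_k)=\sum_{i+j=k-1}(x_1-z)^ic_j$. The shifted diagram of $\lambda$ consists of the boxes $(i,j)$ with $i\le j\le i+\lambda_i-1$. A strict partition $\mu$ is obtained from $\lambda$ by removing a border strip if the diagram of $\mu$ is contained in that of $\lambda$ and the set $\lambda/\mu$ of remaining boxes has at most one box on each diagonal $j-i=\text{const}$. (The strip may be empty or disconnected.) Let $h(\lambda/\mu)$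 be the number of horizontal lines between boxes of $\lambda/\mu$ (pairs of vertically adjacent boxes), $v(\lambda/\mu)$ the number of vertical lines between boxes of $\lambda/\mu$ (pairs of horizontally adjacent boxes), and $k(\lambda/\mu)$ the number of connected components of $\lambda/\mu$, where boxes are joined when they share an edge. Then for every strict partition $\lambda$, in $\mathbf{\Gamma}[x,y]$, $$s_0(Q_\lambda)=\sum_{\mu}x_1^{h(\lambda/\mu)}(x_1-z)^{v(\lambda/\mu)}(2x_1-z)^{k(\lambda/\mu)}\,Q_\mu,$$ the sum over all strict $\mu$ obtained from $\lambda$ by removing a border strip, and $$\partial_0(Q_\lambda)=\sum_{\mu}x_1^{h(\lambda/\mu)}(x_1-z)^{v(\lambda/\mu)}(2x_1-z)^{k(\lambda/\mu)-1}\,Q_\mu,$$ the sum over all strict $\mu$ obtained from $\lambda$ by removing a nonempty border strip. -/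

import Mathlib

namespace TypeC

open Finset

/-! ### Pseudo-pfaffians of a Chern series -/

section Pfaffian

variable {R : Type*} [CommRing R]

/-- The integer `binom j i + binom (j-1) i`, where `binom (-1) i = 0`. -/
def pfCoeff : ℕ → ℕ → ℕ
  | 0, i => Nat.choose 0 i
  | j + 1, i => Nat.choose (j + 1) i + Nat.choose j i

/-- The two-row pseudo-pfaffian
`Pf_{p,q}(a,b) = ∑_{0 ≤ i ≤ j ≤ q} (-1)^j (binom j i + binom (j-1) i) z^i a_{p+j-i} b_{q-j}`. -/
def pfTwo (z : R) (a b : ℕ → R) (p q : ℕ) : R :=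
  ∑ j ∈ range (q + 1), ∑ i ∈ range (j + 1),
    (-1) ^ j * (pfCoeff j i : R) * z ^ i * a (p + (j - i)) * b (q - j)

/-- The pseudo-pfaffian `Pf_{l_1,…,l_n}(c) = Pf_{l_1,…,l_n}(c,…,c)`, by expansion: for `n` odd
`∑_{k=1}^n (-1)^{k-1} c_{l_k} Pf_{l without l_k}`, and for `n > 0` even
`∑_{k=2}^n (-1)^k Pf_{l_1,l_k} Pf_{l without l_1, l_k}`. The indices below start from `0`. -/
def pf (z : R) (c : ℕ → R) : List ℕ → R
  | [] => 1
  | p :: t =>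
    if Odd (t.length + 1) then
      ∑ k : Fin (t.length + 1), (-1) ^ (k : ℕ) * c ((p :: t).get k) *
        pf z c ((p :: t).eraseIdx k)
    else
      ∑ k : Fin t.length, (-1) ^ (k : ℕ) * pfTwo z c c p (t.get k) * pf z c (t.eraseIdx k)
  termination_by l => l.length
  decreasing_by
  · have := k.2
    rw [List.length_eraseIdx]
    simp [this]
  · have := k.2
    rw [List.length_eraseIdx]
    simp only [this, if_true, List.length_cons]
    omega

end Pfaffian

/-! ### The ring `Γ = ℤ[z, c₁, c₂, …] / (C₁₁, C₂₂, …)` and the ring `Γ[x, y]` -/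

noncomputable section

/-- The polynomial ring `Λ = ℤ[z][c₁, c₂, …]`. -/
def Lam : Type := MvPolynomial ℕ+ (Polynomial ℤ)

instance : CommRing Lam := inferInstanceAs (CommRing (MvPolynomial ℕ+ (Polynomial ℤ)))

/-- The variable `z` of `Λ`. -/
def Lam.z : Lam := (MvPolynomial.C Polynomial.X : MvPolynomial ℕ+ (Polynomial ℤ))

/-- The elements `c_k` of `Λ`, with `c_0 = 1`. -/
def Lam.c : ℕ → Lam
  | 0 => 1
  | k + 1 => (MvPolynomial.X k.succPNat : MvPolynomial ℕ+ (Polynomial ℤ))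

/-- The ideal of relations `C_{p,p} = Pf_{p,p}(c,c)`, for `p ≥ 1`. -/
def relIdeal : Ideal Lam := Ideal.span {f | ∃ p : ℕ, 0 < p ∧ f = pfTwo Lam.z Lam.c Lam.c p p}

/-- The ring `Γ`. -/
def Gam : Type := Lam ⧸ relIdeal

instance : CommRing Gam := inferInstanceAs (CommRing (Lam ⧸ relIdeal))

/-- The quotient map from `Λ` to `Γ`. -/
def proj : Lam →+* Gam := Ideal.Quotient.mk relIdeal

/-- The element `z` of `Γ`. -/
def Gam.z : Gam := proj Lam.z

/-- The elements `c_k` of `Γ`. -/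
def Gam.c (k : ℕ) : Gam := proj (Lam.c k)

/-- The ring `Γ[x, y]`, with variables `x_i` and `y_i` for positive integers `i`. -/
abbrev GamXY : Type := MvPolynomial (ℕ+ ⊕ ℕ+) Gam

/-- The inclusion of `Γ` into `Γ[x, y]`. -/
abbrev inc : Gam →+* GamXY := MvPolynomial.C

/-- The element `z` of `Γ[x, y]`. -/
def z : GamXY := inc Gam.z

/-- The elements `c_k` of `Γ[x, y]`. -/
def c (k : ℕ) : GamXY := inc (Gam.c k)

/-- The variables `x_i`. -/
def x (i : ℕ+) : GamXY := MvPolynomial.X (Sum.inl i)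

/-- The variables `y_i`. -/
def y (i : ℕ+) : GamXY := MvPolynomial.X (Sum.inr i)

/-! ### Ring homomorphisms out of `Γ` -/

section Lift

variable {R A : Type*} [CommRing R] [CommRing A]

theorem map_pfTwo (f : R →+* A) (z : R) (a b : ℕ → R) (p q : ℕ) :
    f (pfTwo z a b p q) = pfTwo (f z) (fun k => f (a k)) (fun k => f (b k)) p q := by
  simp [pfTwo, map_sum]

/-- The ring homomorphism from `Λ` that takes `z` to `t` and `c_k` to `b_k` for `k ≥ 1`. -/
def lamLift (t : A) (b : ℕ → A) : Lam →+* A :=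
  (MvPolynomial.eval₂Hom (Polynomial.eval₂RingHom (Int.castRingHom A) t) (fun k : ℕ+ => b k) :
    MvPolynomial ℕ+ (Polynomial ℤ) →+* A)

theorem lamLift_z (t : A) (b : ℕ → A) : lamLift t b Lam.z = t := by
  unfold lamLift Lam.z
  refine (MvPolynomial.eval₂Hom_C _ _ _).trans ?_
  simp

theorem lamLift_c (t : A) (b : ℕ → A) (h0 : b 0 = 1) (k : ℕ) : lamLift t b (Lam.c k) = b k := by
  cases k with
  | zero => exact (map_one _).trans h0.symm
  | succ k => exact MvPolynomial.eval₂Hom_X' (Polynomial.eval₂RingHom (Int.castRingHom A) t) _ _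

/-- The ring homomorphism from `Γ` that takes `z` to `t` and `c_k` to `b_k`, for a Chern series
`b` that satisfies the relations. -/
def gamLift (t : A) (b : ℕ → A) (h0 : b 0 = 1) (h : ∀ p, 0 < p → pfTwo t b b p p = 0) :
    Gam →+* A :=
  Ideal.Quotient.lift relIdeal (lamLift t b) (by
    intro f hf
    have hle : relIdeal ≤ RingHom.ker (lamLift t b) := by
      refine Ideal.span_le.2 ?_
      rintro _ ⟨p, hp, rfl⟩
      simp only [SetLike.mem_coe, RingHom.mem_ker, map_pfTwo, lamLift_z, lamLift_c t b h0]
      exact h p hp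
    exact hle hf)

theorem gamLift_z (t : A) (b : ℕ → A) (h0 : b 0 = 1) (h : ∀ p, 0 < p → pfTwo t b b p p = 0) :
    gamLift t b h0 h Gam.z = t :=
  lamLift_z t b

theorem gamLift_c (t : A) (b : ℕ → A) (h0 : b 0 = 1) (h : ∀ p, 0 < p → pfTwo t b b p p = 0)
    (k : ℕ) : gamLift t b h0 h (Gam.c k) = b k :=
  lamLift_c t b h0 k

theorem gam_hom_ext {f g : Gam →+* A} (hz : f Gam.z = g Gam.z)
    (hc : ∀ k, f (Gam.c k) = g (Gam.c k)) : f = g := by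
  have h : f.comp proj = g.comp proj := by
    refine MvPolynomial.ringHom_ext' (σ := ℕ+) (R := Polynomial ℤ)
      (Polynomial.ringHom_ext' (RingHom.ext_int _ _) hz) fun k => ?_
    have h1 := hc (k.natPred + 1)
    have h2 : Lam.c (k.natPred + 1) = (MvPolynomial.X k : MvPolynomial ℕ+ (Polynomial ℤ)) :=
      congrArg MvPolynomial.X (PNat.succPNat_natPred k)
    unfold Gam.c at h1
    rw [h2] at h1
    exact h1
  ext u
  obtain ⟨v, rfl⟩ := Ideal.Quotient.mk_surjective (I := relIdeal) u
  exact RingHom.congr_fun h v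

theorem gam_rel (p : ℕ) (hp : 0 < p) : pfTwo Gam.z Gam.c Gam.c p p = 0 := by
  have h := map_pfTwo proj Lam.z Lam.c Lam.c p p
  rw [show proj (pfTwo Lam.z Lam.c Lam.c p p) = 0 from
    Ideal.Quotient.eq_zero_iff_mem.2 (Ideal.subset_span ⟨p, hp, rfl⟩)] at h
  exact h.symm

theorem c_zero : c 0 = 1 := by
  rw [c, Gam.c, Lam.c, map_one, map_one]

theorem c_rel (p : ℕ) (hp : 0 < p) : pfTwo z c c p p = 0 := by
  have h := map_pfTwo inc Gam.z Gam.c Gam.c p p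
  rw [gam_rel p hp, map_zero] at h
  exact h.symm

end Lift

/-! ### Multiplying a Chern series by a fraction of two linear factors -/

section Twist

variable {R : Type*} [CommRing R]

/-- The series `b_k = c_k + d ∑_{i+j=k-1} u^i c_j`, that is,
`b = c (1 + (d - u) t) / (1 - u t)`. -/
def twist (u d : R) (c : ℕ → R) (k : ℕ) : R :=
  c k + d * ∑ i ∈ range k, u ^ i * c (k - 1 - i)

theorem twist_zero (u d : R) (c : ℕ → R) : twist u d c 0 = c 0 := by
  simp [twist]

theorem twist_succ (u d : R) (c : ℕ → R) (k : ℕ) :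
    twist u d c (k + 1) = c (k + 1) + (d - u) * c k + u * twist u d c k := by
  have h : ∑ i ∈ range (k + 1), u ^ i * c (k + 1 - 1 - i)
      = c k + u * ∑ i ∈ range k, u ^ i * c (k - 1 - i) := by
    rw [Finset.sum_range_succ', mul_sum, add_comm]
    congr 1
    · simp
    · refine Finset.sum_congr rfl fun i _ => ?_
      rw [pow_succ, show k + 1 - 1 - (i + 1) = k - 1 - i by omega]
      ring
  unfold twist
  rw [h]
  ring

/-- The coefficients of `(1 + r t) b`. -/
def lin (r : R) (b : ℕ → R) : ℕ → R
  | 0 => b 0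
  | k + 1 => b (k + 1) + r * b k

theorem lin_twist (u d : R) (c : ℕ → R) : lin (-u) (twist u d c) = lin (d - u) c := by
  funext k
  cases k with
  | zero => simp [lin, twist_zero]
  | succ k =>
    simp only [lin, twist_succ]
    ring

theorem pfTwo_lin_left (z r : R) (a b : ℕ → R) (p q : ℕ) :
    pfTwo z (lin r a) b (p + 1) q = pfTwo z a b (p + 1) q + r * pfTwo z a b p q := by
  unfold pfTwo
  rw [mul_sum, ← Finset.sum_add_distrib]
  refine Finset.sum_congr rfl fun j _ => ?_
  rw [mul_sum, ← Finset.sum_add_distrib]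
  refine Finset.sum_congr rfl fun i _ => ?_
  rw [show p + 1 + (j - i) = p + (j - i) + 1 by omega]
  simp only [lin]
  ring

theorem pfTwo_lin_right (z r : R) (a b : ℕ → R) (p q : ℕ) :
    pfTwo z a (lin r b) p (q + 1) = pfTwo z a b p (q + 1) + r * pfTwo z a b p q := by
  unfold pfTwo
  conv_lhs => rw [Finset.sum_range_succ]
  conv_rhs => rw [Finset.sum_range_succ, add_right_comm, mul_sum, ← Finset.sum_add_distrib]
  congr 1
  · refine Finset.sum_congr rfl fun j hj => ?_
    rw [mul_sum, ← Finset.sum_add_distrib]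
    refine Finset.sum_congr rfl fun i _ => ?_
    rw [show q + 1 - j = q - j + 1 by have := Finset.mem_range.1 hj; omega]
    simp only [lin]
    ring
  · simp [lin]

theorem pfCoeff_succ (j i : ℕ) (hj : 0 < j) :
    pfCoeff (j + 1) (i + 1) = pfCoeff j (i + 1) + pfCoeff j i := by
  obtain ⟨j, rfl⟩ := Nat.exists_eq_add_of_lt hj
  simp only [zero_add, pfCoeff, Nat.choose_succ_succ']
  omega

theorem pfCoeff_eq_zero (j i : ℕ) (h : j < i) : pfCoeff j i = 0 := by
  cases j with
  | zero => exact Nat.choose_eq_zero_of_lt h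
  | succ j =>
    simp [pfCoeff, Nat.choose_eq_zero_of_lt h, Nat.choose_eq_zero_of_lt (show j < i by omega)]

theorem pfTwo_swap_aux (z : R) (c : ℕ → R) (q j : ℕ) (hj : 0 < j) :
    (∑ i ∈ range (j + 1),
        (-1) ^ j * (pfCoeff j i : R) * z ^ i * c (q + 1 + (j - i)) * c (q - j)) +
      ∑ i ∈ range (j + 1 + 1), (-1) ^ (j + 1) * (pfCoeff (j + 1) i : R) * z ^ i *
        c (q + (j + 1 - i)) * c (q + 1 - (j + 1)) =
      -z * ∑ i ∈ range (j + 1),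
        (-1) ^ j * (pfCoeff j i : R) * z ^ i * c (q + (j - i)) * c (q - j) := by
  have h1 : (∑ i ∈ range (j + 1),
        (-1) ^ j * (pfCoeff j i : R) * z ^ i * c (q + 1 + (j - i)) * c (q - j)) =
      ∑ i ∈ range (j + 1 + 1),
        (-1) ^ j * (pfCoeff j i : R) * z ^ i * c (q + 1 + (j - i)) * c (q - j) := by
    rw [Finset.sum_range_succ _ (j + 1), pfCoeff_eq_zero j (j + 1) (by omega)]
    simp
  have h0 : pfCoeff (j + 1) 0 = pfCoeff j 0 := by
    obtain ⟨j, rfl⟩ := Nat.exists_eq_add_of_lt hj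
    simp [pfCoeff]
  rw [h1, Finset.sum_range_succ', Finset.sum_range_succ' (n := j + 1), mul_sum, h0]
  have h2 : ∀ i ∈ range (j + 1),
      (-1) ^ j * (pfCoeff j (i + 1) : R) * z ^ (i + 1) * c (q + 1 + (j - (i + 1))) * c (q - j) +
        (-1) ^ (j + 1) * (pfCoeff (j + 1) (i + 1) : R) * z ^ (i + 1) *
          c (q + (j + 1 - (i + 1))) * c (q + 1 - (j + 1)) =
      -z * ((-1) ^ j * (pfCoeff j i : R) * z ^ i * c (q + (j - i)) * c (q - j)) := by
    intro i hi
    rw [pfCoeff_succ j i hj, show q + (j + 1 - (i + 1)) = q + (j - i) by omega,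
      show q + 1 - (j + 1) = q - j by omega]
    rcases Nat.lt_or_ge i j with hij | hij
    · rw [show q + 1 + (j - (i + 1)) = q + (j - i) by omega]
      push_cast
      ring
    · rw [pfCoeff_eq_zero j (i + 1) (by omega)]
      push_cast
      ring
  rw [← Finset.sum_congr rfl h2, Finset.sum_add_distrib,
    show q + 1 + (j - 0) = q + (j + 1 - 0) by omega, show q + 1 - (j + 1) = q - j by omega]
  ring

theorem pfTwo_swap (z : R) (c : ℕ → R) (q : ℕ) :
    pfTwo z c c (q + 1) q + pfTwo z c c q (q + 1) = -z * pfTwo z c c q q := by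
  unfold pfTwo
  rw [Finset.sum_range_succ' _ (q + 1), ← add_assoc, ← Finset.sum_add_distrib, mul_sum,
    Finset.sum_range_succ', Finset.sum_range_succ' (n := q), add_assoc]
  congr 1
  · exact Finset.sum_congr rfl fun j _ => pfTwo_swap_aux z c q (j + 1) (by omega)
  · simp [pfCoeff, Finset.sum_range_succ]
    ring

theorem pfTwo_twist (z u d : R) (h : d * (d - 2 * u - z) = 0) (c : ℕ → R) (p : ℕ) :
    pfTwo z (twist u d c) (twist u d c) p p = pfTwo z c c p p := by
  have step : ∀ (r : R) (b : ℕ → R) (p : ℕ), pfTwo z (lin r b) (lin r b) (p + 1) (p + 1) =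
      pfTwo z b b (p + 1) (p + 1) + (r ^ 2 - r * z) * pfTwo z b b p p := by
    intro r b p
    rw [pfTwo_lin_left, pfTwo_lin_right, pfTwo_lin_right]
    linear_combination r * pfTwo_swap z b p
  induction p with
  | zero => simp [pfTwo, twist_zero]
  | succ p ih =>
    have h1 := step (-u) (twist u d c) p
    rw [lin_twist, step, ih] at h1
    linear_combination (pfTwo z c c p p) * h - h1

end Twist

/-! ### The endomorphism `s_0` and the difference operator `∂_0` -/

/-- `s_0` fixes `z`, the `y_i`, and the `x_i` for `i ≥ 2`, it takes `x_1` to `z - x_1`, and it takes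
the Chern series `c` to `c (1 + x_1 t) / (1 + (z - x_1) t)`. -/
def s0 : GamXY →+* GamXY :=
  MvPolynomial.eval₂Hom
    (gamLift z (twist (x 1 - z) (2 * x 1 - z) c) (by
        rw [twist_zero]
        exact c_zero)
      (by
        intro p hp
        rw [pfTwo_twist _ _ _ (by ring)]
        exact c_rel p hp))
    (Sum.elim (fun i => if i = 1 then z - x 1 else x i) y)

/-- The ring `Γ[x, y][ε]`, where `ε² = (z - 2 x_1) ε`. -/
abbrev Dual : Type := QuadraticAlgebra GamXY 0 (z - 2 * x 1)

/-- The element `ε`. -/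
def eps : Dual := ⟨0, 1⟩

/-- The element `f` of `Γ[x, y]`, as an element of `Γ[x, y][ε]`. -/
abbrev toDual : GamXY →+* Dual := algebraMap GamXY Dual

theorem eps_sq : eps * eps = toDual (z - 2 * x 1) * eps := by
  ext <;> simp [eps, QuadraticAlgebra.algebraMap_re, QuadraticAlgebra.algebraMap_im]

/-- The ring homomorphism `f ↦ f - ε ∂_0(f)`. That it respects products is the rule
`∂_0(fg) = f ∂_0(g) + g ∂_0(f) - (z - 2 x_1) ∂_0(f) ∂_0(g)`. On generators it is given by
`∂_0(z) = 0`, `∂_0(x_1) = -1`, `∂_0(x_i) = 0` for `i ≥ 2`, `∂_0(y_i) = 0`, and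
`∂_0(c_k) = ∑_{i+j=k-1} (x_1 - z)^i c_j`. -/
def del0Hom : GamXY →+* Dual :=
  MvPolynomial.eval₂Hom
    (gamLift (toDual z) (twist (toDual (x 1 - z)) (-eps) (fun k => toDual (c k))) (by
        rw [twist_zero, c_zero, map_one])
      (by
        intro p hp
        rw [pfTwo_twist, ← map_pfTwo, c_rel p hp, map_zero]
        have h := eps_sq
        simp only [map_sub, map_mul, map_ofNat] at h ⊢
        linear_combination h))
    (Sum.elim (fun i => if i = 1 then toDual (x 1) + eps else toDual (x i))
      (fun i => toDual (y i)))

/-- The difference operator `∂_0`; see `del0_spec` for `∂_0(f) = (f - s_0(f)) / (z - 2 x_1)`. -/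
def del0 (f : GamXY) : GamXY := -(del0Hom f).im

theorem s0_z : s0 z = z :=
  (MvPolynomial.eval₂Hom_C _ _ _).trans (gamLift_z _ _ _ _)

theorem s0_c (k : ℕ) :
    s0 (c k) = c k + (2 * x 1 - z) * ∑ i ∈ range k, (x 1 - z) ^ i * c (k - 1 - i) :=
  (MvPolynomial.eval₂Hom_C _ _ _).trans (gamLift_c _ _ _ _ k)

theorem s0_x (i : ℕ+) : s0 (x i) = if i = 1 then z - x 1 else x i :=
  MvPolynomial.eval₂Hom_X' _ _ _

theorem s0_y (i : ℕ+) : s0 (y i) = y i :=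
  MvPolynomial.eval₂Hom_X' _ _ _

theorem del0Hom_z : del0Hom z = toDual z :=
  (MvPolynomial.eval₂Hom_C _ _ _).trans (gamLift_z _ _ _ _)

theorem del0Hom_c (k : ℕ) :
    del0Hom (c k) = twist (toDual (x 1 - z)) (-eps) (fun k => toDual (c k)) k :=
  (MvPolynomial.eval₂Hom_C _ _ _).trans (gamLift_c _ _ _ _ k)

theorem del0Hom_x (i : ℕ+) :
    del0Hom (x i) = if i = 1 then toDual (x 1) + eps else toDual (x i) :=
  MvPolynomial.eval₂Hom_X' _ _ _

theorem del0Hom_y (i : ℕ+) : del0Hom (y i) = toDual (y i) :=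
  MvPolynomial.eval₂Hom_X' _ _ _

theorem gamXY_hom_ext {A : Type*} [CommRing A] {f g : GamXY →+* A} (hz : f z = g z)
    (hc : ∀ k, f (c k) = g (c k)) (hx : ∀ i, f (x i) = g (x i)) (hy : ∀ i, f (y i) = g (y i)) :
    f = g := by
  refine MvPolynomial.ringHom_ext' (gam_hom_ext hz hc) ?_
  rintro (i | i)
  · exact hx i
  · exact hy i

/-- The ring homomorphism from `Γ[x, y][ε]` to `Γ[x, y]` that takes `ε` to `v`. -/
def evalEps (v : GamXY) (hv : v * v = (z - 2 * x 1) * v) : Dual →+* GamXY where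
  toFun w := w.re + w.im * v
  map_zero' := by simp
  map_one' := by simp [QuadraticAlgebra.re_one, QuadraticAlgebra.im_one]
  map_add' w w' := by
    simp only [QuadraticAlgebra.re_add, QuadraticAlgebra.im_add]
    ring
  map_mul' w w' := by
    simp only [QuadraticAlgebra.re_mul, QuadraticAlgebra.im_mul]
    linear_combination -(w.im * w'.im) * hv

theorem evalEps_eps (v : GamXY) (hv : v * v = (z - 2 * x 1) * v) : evalEps v hv eps = v := by
  simp [evalEps, eps]

theorem evalEps_toDual (v : GamXY) (hv : v * v = (z - 2 * x 1) * v) (f : GamXY) :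
    evalEps v hv (toDual f) = f := by
  simp [evalEps, QuadraticAlgebra.algebraMap_re, QuadraticAlgebra.algebraMap_im]

theorem evalEps_del0Hom_c (v : GamXY) (hv : v * v = (z - 2 * x 1) * v) (k : ℕ) :
    evalEps v hv (del0Hom (c k)) = twist (x 1 - z) (-v) c k := by
  rw [del0Hom_c]
  simp only [twist, map_add, map_mul, map_neg, map_sum, map_pow, evalEps_eps, evalEps_toDual]

theorem evalEps_del0Hom_zero (f : GamXY) : evalEps 0 (by simp) (del0Hom f) = f := by
  have h : (evalEps 0 (by simp)).comp del0Hom = RingHom.id GamXY := by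
    refine gamXY_hom_ext ?_ (fun k => ?_) (fun i => ?_) (fun i => ?_) <;>
      simp only [RingHom.comp_apply, RingHom.id_apply]
    · rw [del0Hom_z, evalEps_toDual]
    · rw [evalEps_del0Hom_c]
      simp [twist]
    · rw [del0Hom_x]
      split_ifs with hi
      · rw [map_add, evalEps_toDual, evalEps_eps, add_zero, hi]
      · rw [evalEps_toDual]
    · rw [del0Hom_y, evalEps_toDual]
  exact RingHom.congr_fun h f

theorem evalEps_del0Hom_s0 (f : GamXY) :
    evalEps (z - 2 * x 1) rfl (del0Hom f) = s0 f := by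
  have h : (evalEps (z - 2 * x 1) rfl).comp del0Hom = s0 := by
    refine gamXY_hom_ext ?_ (fun k => ?_) (fun i => ?_) (fun i => ?_) <;>
      simp only [RingHom.comp_apply]
    · rw [del0Hom_z, evalEps_toDual, s0_z]
    · rw [evalEps_del0Hom_c, s0_c, twist]
      ring
    · rw [del0Hom_x, s0_x]
      split_ifs with hi
      · rw [map_add, evalEps_toDual, evalEps_eps]
        ring
      · rw [evalEps_toDual]
    · rw [del0Hom_y, evalEps_toDual, s0_y]
  exact RingHom.congr_fun h f

/-- `∂_0(f) = (f - s_0(f)) / (z - 2 x_1)`. -/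
theorem del0_spec (f : GamXY) : (z - 2 * x 1) * del0 f = f - s0 f := by
  have h0 : (del0Hom f).re + (del0Hom f).im * 0 = f := evalEps_del0Hom_zero f
  have h1 : (del0Hom f).re + (del0Hom f).im * (z - 2 * x 1) = s0 f := evalEps_del0Hom_s0 f
  rw [del0]
  linear_combination h0 - h1

end

/-! ### Strict partitions, shifted diagrams and border strips -/

/-- A strict partition, given by the list of its (positive) parts in decreasing order. -/
@[ext]
structure StrictPartition where
  parts : List ℕ
  decreasing : parts.Pairwise (· > ·)
  pos : ∀ p ∈ parts, 0 < p

namespace StrictPartition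

/-- The shifted diagram: the boxes `(i, j)` (row `i`, column `j`, both numbered from `0`) with
`i ≤ j < i + l_i`, where `l_i` is the part with index `i`. -/
def diagram (l : StrictPartition) : Finset (ℕ × ℕ) :=
  (range l.parts.length).biUnion fun i =>
    (Ico i (i + l.parts.getD i 0)).image fun j => (i, j)

theorem mem_diagram (l : StrictPartition) (i j : ℕ) :
    (i, j) ∈ l.diagram ↔ i ≤ j ∧ j < i + l.parts.getD i 0 := by
  simp only [diagram, mem_biUnion, Finset.mem_range, mem_image, Finset.mem_Ico, Prod.mk.injEq]
  constructor
  · rintro ⟨i', _, j', h, rfl, rfl⟩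
    exact h
  · intro h
    refine ⟨i, ?_, j, h, rfl, rfl⟩
    by_contra hi
    rw [List.getD_eq_default _ _ (by omega)] at h
    omega

theorem diagram_injective : Function.Injective diagram := by
  intro l m h
  have hD : ∀ i, l.parts.getD i 0 = m.parts.getD i 0 := by
    intro i
    have h1 : ∀ j, (i ≤ j ∧ j < i + l.parts.getD i 0) ↔ (i ≤ j ∧ j < i + m.parts.getD i 0) := by
      intro j
      rw [← mem_diagram, ← mem_diagram, h]
    have h2 := h1 (i + l.parts.getD i 0)
    have h3 := h1 (i + m.parts.getD i 0)
    omega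
  have hP : ∀ (n : StrictPartition) (i : ℕ), i < n.parts.length ↔ 0 < n.parts.getD i 0 := by
    intro n i
    constructor
    · intro hi
      rw [List.getD_eq_getElem _ _ hi]
      exact n.pos _ (List.getElem_mem hi)
    · intro hi
      by_contra hc
      rw [List.getD_eq_default _ _ (by omega)] at hi
      omega
  refine StrictPartition.ext (List.ext_getElem ?_ fun i hl hm => ?_)
  · have h1 : ∀ i, i < l.parts.length ↔ i < m.parts.length := fun i => by
      rw [hP l i, hP m i, hD i]
    have h2 := h1 l.parts.length
    have h3 := h1 m.parts.length
    omega
  · have := hD i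
    rwa [List.getD_eq_getElem _ _ hl, List.getD_eq_getElem _ _ hm] at this

/-- The boxes of the shifted skew shape `l/m`. -/
def skew (l m : StrictPartition) : Finset (ℕ × ℕ) := l.diagram \ m.diagram

/-- `m` is obtained from `l` by removing a border strip (possibly empty or disconnected): `m ⊆ l`,
and `l/m` has no two boxes on the same diagonal. -/
def IsBorderStrip (l m : StrictPartition) : Prop :=
  m.diagram ⊆ l.diagram ∧
    ∀ a ∈ skew l m, ∀ b ∈ skew l m, a.1 + b.2 = b.1 + a.2 → a = b

theorem finite_isBorderStrip (l : StrictPartition) : {m | IsBorderStrip l m}.Finite := by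
  refine Set.Finite.subset (Set.Finite.preimage diagram_injective.injOn
    (l.diagram.powerset.finite_toSet)) fun m hm => ?_
  simpa using hm.1

/-- The strict partitions obtained from `l` by removing a border strip. -/
noncomputable def removals (l : StrictPartition) : Finset StrictPartition :=
  l.finite_isBorderStrip.toFinset

theorem mem_removals (l m : StrictPartition) : m ∈ l.removals ↔ IsBorderStrip l m := by
  simp [removals]

end StrictPartition

/-- The number of horizontal lines between boxes of `S`: pairs of boxes, one right below the
other. -/
def hLines (S : Finset (ℕ × ℕ)) : ℕ := #{b ∈ S | (b.1 + 1, b.2) ∈ S}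

/-- The number of vertical lines between boxes of `S`: pairs of boxes, side by side in a row. -/
def vLines (S : Finset (ℕ × ℕ)) : ℕ := #{b ∈ S | (b.1, b.2 + 1) ∈ S}

/-- The graph on all boxes, where two boxes are adjacent when they share an edge. -/
def boxGraph : SimpleGraph (ℕ × ℕ) :=
  SimpleGraph.fromRel fun a b => b = (a.1, a.2 + 1) ∨ b = (a.1 + 1, a.2)

/-- The number of connected components of `S`. -/
noncomputable def numComponents (S : Finset (ℕ × ℕ)) : ℕ :=
  Nat.card (boxGraph.induce (S : Set (ℕ × ℕ))).ConnectedComponent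

/-- The basis element `Q_l = Pf_l(c)` of `Γ`. -/
noncomputable def Q (l : StrictPartition) : Gam := pf Gam.z Gam.c l.parts

end TypeC

/-! Both formulas are instances of one expansion, `pf_twist_eq_sum`. It writes the pseudo-pfaffians
of the series `b = c (1 + (d - u) t) / (1 - u t)`, where `d (d - 2u - z) = 0`, as a sum over border
strips.

The pfaffian `Pf_λ(c)` is the Wick functional of an alternating form, evaluated on `e_{λ_1} ∧ … ∧
e_{λ_n}` (`pfWick_wedge`), with the vector `star` in front if `n` is odd. For the same form, the
vectors `twistVec u d p`, which are twisted just as `b` is from `c`, give `Pf_λ(b)`; this is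
`pfForm_twistVec`, where the condition on `d` enters. The twist thus moves from the form to the
vectors, and exterior algebra applies. In the wedge product, a multiple of the next factor may be
subtracted from each factor, which leaves `rowVec`, supported on `e_a` with `λ_{i+1} ≤ a ≤ λ_i`. The
multilinear expansion then runs over interlacing sequences, and only the strictly decreasing ones
survive. These are the strict `μ` with `λ/μ` a border strip (`sum_interlacing`). A last entry `0`
can be dropped by `pfWick_concat_zero`.

The coefficients are products over rows. They match `h`, `v` and `k` because a border strip is a
forest: its boxes number `k + h + v` (`numComponents_add`).

For `s_0`, take `u = x_1 - z` and `d = 2 x_1 - z`. For `∂_0`, take the same `u` and `d = -ε` in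
`Γ[x, y][ε]`, and read off the coefficient of `ε`; no cancellation of `z - 2 x_1` is needed. -/

namespace TypeC

open Finset

/-! ### Recurrence and antisymmetry of the two-row pseudo-pfaffians. -/

section PseudoPfaffian

variable {R : Type*} [CommRing R]

/-- Pascal's rule for `pfCoeff`, applied to row `j` of one sum and row `j + 1` of the other. It
fails between rows `0` and `1`, hence `0 < j`. -/
theorem pfTwo_add_pfTwo_aux (z : R) (a b : ℕ → R) (p q j : ℕ) (hj : 0 < j) :
    (∑ i ∈ range (j + 1),
        (-1) ^ j * (pfCoeff j i : R) * z ^ i * a (p + 1 + (j - i)) * b (q - j)) +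
      ∑ i ∈ range (j + 1 + 1), (-1) ^ (j + 1) * (pfCoeff (j + 1) i : R) * z ^ i *
        a (p + (j + 1 - i)) * b (q + 1 - (j + 1)) =
      -z * ∑ i ∈ range (j + 1),
        (-1) ^ j * (pfCoeff j i : R) * z ^ i * a (p + (j - i)) * b (q - j) := by
  have h1 : (∑ i ∈ range (j + 1),
        (-1) ^ j * (pfCoeff j i : R) * z ^ i * a (p + 1 + (j - i)) * b (q - j)) =
      ∑ i ∈ range (j + 1 + 1),
        (-1) ^ j * (pfCoeff j i : R) * z ^ i * a (p + 1 + (j - i)) * b (q - j) := by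
    rw [Finset.sum_range_succ _ (j + 1), pfCoeff_eq_zero j (j + 1) (by omega)]
    simp
  have h0 : pfCoeff (j + 1) 0 = pfCoeff j 0 := by
    obtain ⟨j, rfl⟩ := Nat.exists_eq_add_of_lt hj
    simp [pfCoeff]
  rw [h1, Finset.sum_range_succ', Finset.sum_range_succ' (n := j + 1), mul_sum, h0]
  have h2 : ∀ i ∈ range (j + 1),
      (-1) ^ j * (pfCoeff j (i + 1) : R) * z ^ (i + 1) * a (p + 1 + (j - (i + 1))) * b (q - j) +
        (-1) ^ (j + 1) * (pfCoeff (j + 1) (i + 1) : R) * z ^ (i + 1) *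
          a (p + (j + 1 - (i + 1))) * b (q + 1 - (j + 1)) =
      -z * ((-1) ^ j * (pfCoeff j i : R) * z ^ i * a (p + (j - i)) * b (q - j)) := by
    intro i hi
    rw [pfCoeff_succ j i hj, show p + (j + 1 - (i + 1)) = p + (j - i) by omega,
      show q + 1 - (j + 1) = q - j by omega]
    rcases Nat.lt_or_ge i j with hij | hij
    · rw [show p + 1 + (j - (i + 1)) = p + (j - i) by omega]
      push_cast
      ring
    · rw [pfCoeff_eq_zero j (i + 1) (by omega)]
      push_cast
      ring
  rw [← Finset.sum_congr rfl h2, Finset.sum_add_distrib,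
    show p + 1 + (j - 0) = p + (j + 1 - 0) by omega, show q + 1 - (j + 1) = q - j by omega]
  ring

/-- The recurrence which says that the generating function of the `Pf_{p,q}` is
`(s - t) / (s + t + z s t)` times that of the products `a_p b_q`. -/
theorem pfTwo_add_pfTwo (z : R) (a b : ℕ → R) (p q : ℕ) :
    pfTwo z a b (p + 1) q + pfTwo z a b p (q + 1) =
      -z * pfTwo z a b p q + (a p * b (q + 1) - a (p + 1) * b q) := by
  unfold pfTwo
  rw [Finset.sum_range_succ' _ (q + 1), ← add_assoc, ← Finset.sum_add_distrib, mul_sum,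
    Finset.sum_range_succ', Finset.sum_range_succ' (n := q)]
  have h : ∀ {s t u v s' t' : R}, s = s' → t + u = t' + v → s + t + u = s' + t' + v := by
    intro s t u v s' t' h1 h2
    linear_combination h1 + h2
  refine h ?_ ?_
  · exact Finset.sum_congr rfl fun j _ => pfTwo_add_pfTwo_aux z a b p q (j + 1) (by omega)
  -- The low rows, where Pascal's rule fails, produce the products `a_p b_{q+1} - a_{p+1} b_q`.
  · simp [pfCoeff, Finset.sum_range_succ]
    ring

theorem pfTwo_zero_right (z : R) (a b : ℕ → R) (p : ℕ) : pfTwo z a b p 0 = a p * b 0 := by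
  simp [pfTwo, pfCoeff]

/-- Adding the recurrences for `(p, q)` and `(q, p)` cancels the product terms, so the symmetrized
values satisfy a homogeneous recurrence. Induction on the difference of the indices, for two
consecutive differences at once, spreads the vanishing from the diagonal. -/
theorem pfTwo_antisymm (z : R) (c : ℕ → R) (h : ∀ p, 0 < p → pfTwo z c c p p = 0) {p q : ℕ}
    (hp : 0 < p) (hq : 0 < q) : pfTwo z c c p q = -pfTwo z c c q p := by
  have key : ∀ m p, 0 < p → pfTwo z c c p (p + m) + pfTwo z c c (p + m) p = 0 ∧
      pfTwo z c c p (p + m + 1) + pfTwo z c c (p + m + 1) p = 0 := by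
    intro m
    induction m with
    | zero =>
      intro p hp
      have := pfTwo_swap z c p
      rw [h p hp] at this
      exact ⟨by simp [h p hp], by simpa [add_comm] using this⟩
    | succ m ih =>
      intro p hp
      refine ⟨(ih p hp).2, ?_⟩
      have h1 := (ih (p + 1) (by omega)).1
      have h2 := (ih p hp).2
      have h3 := pfTwo_add_pfTwo z c c p (p + m + 1)
      have h4 := pfTwo_add_pfTwo z c c (p + m + 1) p
      rw [show p + 1 + m = p + m + 1 by omega] at h1
      rw [show p + (m + 1) + 1 = p + m + 1 + 1 by omega]
      linear_combination h3 + h4 - h1 - z * h2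
  rcases le_total p q with hpq | hpq
  · obtain ⟨m, rfl⟩ := Nat.exists_eq_add_of_le hpq
    linear_combination (key m p hp).1
  · obtain ⟨m, rfl⟩ := Nat.exists_eq_add_of_le hpq
    linear_combination (key m q hq).1

/-- The power of `-z` is the defect of antisymmetry at index `0`, since `Pf_{q+1,0} = c_{q+1}`. -/
theorem pfTwo_zero_left (z : R) (c : ℕ → R) (h0 : c 0 = 1)
    (h : ∀ p, 0 < p → pfTwo z c c p p = 0) (q : ℕ) :
    pfTwo z c c 0 (q + 1) = -c (q + 1) + (-z) ^ (q + 1) := by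
  induction q with
  | zero =>
    have h1 := pfTwo_add_pfTwo z c c 0 0
    simp only [pfTwo_zero_right, h0, zero_add] at h1 ⊢
    linear_combination h1
  | succ q ih =>
    have h1 := pfTwo_add_pfTwo z c c 0 (q + 1)
    have h2 := pfTwo_add_pfTwo z c c (q + 1) 0
    have h3 := pfTwo_antisymm z c h (p := 1) (q := q + 1) (by omega) (by omega)
    simp only [pfTwo_zero_right, h0, zero_add] at h1 h2
    rw [pow_succ]
    linear_combination h1 + h2 - h3 - z * ih

end PseudoPfaffian

noncomputable section

/-! ### The alternating form and the twisted vectors. -/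

section Form

variable {R : Type*} [CommRing R]

/-- The vectors `e_p`, which span together with `star` the module `Option ℕ →₀ R`. -/
def e (R : Type*) [CommRing R] (p : ℕ) : Option ℕ →₀ R := Finsupp.single (some p) 1

/-- The vector which completes an odd number of vectors to an even number. -/
def star (R : Type*) [CommRing R] : Option ℕ →₀ R := Finsupp.single none 1

/-- The entries below the diagonal of the alternating form `pfForm`. -/
def pfEntry (z : R) (c : ℕ → R) : Option ℕ → Option ℕ → R
  | some p, some q => if q < p then pfTwo z c c p q else 0
  | none, some p => c p
  | _, none => 0

/-- The bilinear form with matrix `pfEntry`. -/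
def pfEntryForm (z : R) (c : ℕ → R) : (Option ℕ →₀ R) →ₗ[R] (Option ℕ →₀ R) →ₗ[R] R :=
  Finsupp.linearCombination R fun i => Finsupp.linearCombination R (pfEntry z c i)

/-- The alternating form with values `Pf_{p,q}` on `(e_p, e_q)` and `c_p` on `(star, e_p)`. -/
def pfForm (z : R) (c : ℕ → R) : (Option ℕ →₀ R) →ₗ[R] (Option ℕ →₀ R) →ₗ[R] R :=
  pfEntryForm z c - (pfEntryForm z c).flip

theorem pfForm_self (z : R) (c : ℕ → R) (v : Option ℕ →₀ R) : pfForm z c v v = 0 := by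
  simp [pfForm]

theorem pfForm_swap (z : R) (c : ℕ → R) (v w : Option ℕ →₀ R) :
    pfForm z c v w = -pfForm z c w v := by
  simp [pfForm]

theorem pfForm_e_e (z : R) (c : ℕ → R) (p q : ℕ) : pfForm z c (e R p) (e R q) =
    (if q < p then pfTwo z c c p q else 0) - if p < q then pfTwo z c c q p else 0 := by
  simp [pfForm, pfEntryForm, e, pfEntry]

theorem pfForm_star_e (z : R) (c : ℕ → R) (p : ℕ) : pfForm z c (star R) (e R p) = c p := by
  simp [pfForm, pfEntryForm, e, star, pfEntry]

theorem pfForm_e_zero (z : R) (c : ℕ → R) (h0 : c 0 = 1) {p : ℕ} (hp : 0 < p) :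
    pfForm z c (e R 0) (e R p) = -c p := by
  simp [pfForm_e_e, hp, pfTwo_zero_right, h0]

theorem pfForm_pos (z : R) (c : ℕ → R) (h : ∀ p, 0 < p → pfTwo z c c p p = 0) {p q : ℕ}
    (hp : 0 < p) (hq : 0 < q) : pfForm z c (e R p) (e R q) = pfTwo z c c p q := by
  rw [pfForm_e_e]
  rcases lt_trichotomy p q with hpq | rfl | hpq
  · simp [hpq, hpq.not_gt, pfTwo_antisymm z c h hp hq]
  · simp [h p hp]
  · simp [hpq, hpq.not_gt]

/-- The coefficients of `(1 + (d - u) t) / (1 - u t)` times the series with coefficients `e_p`. -/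
def twistVec (u d : R) : ℕ → Option ℕ →₀ R
  | 0 => e R 0
  | p + 1 => e R (p + 1) + (d - u) • e R p + u • twistVec u d p

theorem pfForm_star_twistVec (z u d : R) (c : ℕ → R) (p : ℕ) :
    pfForm z c (star R) (twistVec u d p) = twist u d c p := by
  induction p with
  | zero => simp [twistVec, pfForm_star_e, twist_zero]
  | succ p ih => simp [twistVec, pfForm_star_e, twist_succ, ih]

theorem pfForm_zero_twistVec (z u d : R) (c : ℕ → R) (h0 : c 0 = 1) (q : ℕ) :
    pfForm z c (e R 0) (twistVec u d (q + 1)) = d * u ^ q - twist u d c (q + 1) := by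
  induction q with
  | zero =>
    simp [twistVec, twist_succ, twist_zero, pfForm_self, pfForm_e_zero z c h0, h0]
    ring
  | succ q ih =>
    rw [twistVec, map_add, map_add, map_smul, map_smul, ih, pfForm_e_zero z c h0 (by omega),
      pfForm_e_zero z c h0 (by omega), twist_succ _ _ _ (q + 1)]
    simp only [smul_eq_mul]
    ring

/-- Since `(1 - u t) b = (1 + (d - u) t) c`, bilinearity gives this by comparing coefficients. The
form on `twistVec` obeys the same recurrence, so only the boundary values remain to be compared. -/
theorem pfTwo_twist_rec (z u d : R) (c : ℕ → R) (p q : ℕ) :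
    pfTwo z (twist u d c) (twist u d c) (p + 1) (q + 1) =
      u * pfTwo z (twist u d c) (twist u d c) p (q + 1) +
      u * pfTwo z (twist u d c) (twist u d c) (p + 1) q -
      u ^ 2 * pfTwo z (twist u d c) (twist u d c) p q +
      (pfTwo z c c (p + 1) (q + 1) + (d - u) * pfTwo z c c p (q + 1) +
        (d - u) * pfTwo z c c (p + 1) q + (d - u) ^ 2 * pfTwo z c c p q) := by
  have step : ∀ (r : R) (b : ℕ → R), pfTwo z (lin r b) (lin r b) (p + 1) (q + 1) =
      pfTwo z b b (p + 1) (q + 1) + r * pfTwo z b b p (q + 1) + r * pfTwo z b b (p + 1) q +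
        r ^ 2 * pfTwo z b b p q := by
    intro r b
    rw [pfTwo_lin_left, pfTwo_lin_right, pfTwo_lin_right]
    ring
  have h := step (-u) (twist u d c)
  rw [lin_twist, step] at h
  linear_combination -h

theorem pfForm_twistVec_rec (z u d : R) (c : ℕ → R) (p q : ℕ) :
    pfForm z c (twistVec u d (p + 1)) (twistVec u d (q + 1)) =
      u * pfForm z c (twistVec u d p) (twistVec u d (q + 1)) +
      u * pfForm z c (twistVec u d (p + 1)) (twistVec u d q) -
      u ^ 2 * pfForm z c (twistVec u d p) (twistVec u d q) +
      (pfForm z c (e R (p + 1)) (e R (q + 1)) + (d - u) * pfForm z c (e R p) (e R (q + 1)) +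
        (d - u) * pfForm z c (e R (p + 1)) (e R q) + (d - u) ^ 2 * pfForm z c (e R p) (e R q)) := by
  simp only [twistVec, map_add, map_smul, LinearMap.add_apply, LinearMap.smul_apply, smul_eq_mul]
  ring

/-- At index `0` the form and `pfTwo` differ by terms in `d u^q` and `(-z)^{q+1}`. In the recurrence
the former cancel between neighbours, and the latter, for `p = 0`, collect into a multiple of `d (d
- 2u - z)`. -/
theorem pfForm_twistVec (z u d : R) (hd : d * (d - 2 * u - z) = 0) (c : ℕ → R) (h0 : c 0 = 1)
    (h : ∀ p, 0 < p → pfTwo z c c p p = 0) (p q : ℕ) :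
    pfForm z c (twistVec u d (p + 1)) (twistVec u d (q + 1)) =
      pfTwo z (twist u d c) (twist u d c) (p + 1) (q + 1) := by
  have h0' : twist u d c 0 = 1 := by rw [twist_zero, h0]
  have h' : ∀ p, 0 < p → pfTwo z (twist u d c) (twist u d c) p p = 0 := fun p hp => by
    rw [pfTwo_twist z u d hd, h p hp]
  have hl : ∀ q, pfForm z c (twistVec u d 0) (twistVec u d (q + 1)) =
      d * u ^ q - twist u d c (q + 1) := pfForm_zero_twistVec z u d c h0
  have hr : ∀ q, pfForm z c (twistVec u d (q + 1)) (twistVec u d 0) =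
      -(d * u ^ q - twist u d c (q + 1)) := fun q => by rw [pfForm_swap, hl]
  have hl0 := pfTwo_zero_left z c h0 h
  have hl1 := pfTwo_zero_left z _ h0' h'
  have hr1 : ∀ p, pfTwo z (twist u d c) (twist u d c) p 0 = twist u d c p := fun p => by
    rw [pfTwo_zero_right, h0', mul_one]
  have he : ∀ p, pfForm z c (e R 0) (e R (p + 1)) = -c (p + 1) := fun p =>
    pfForm_e_zero z c h0 (by omega)
  have hp : ∀ p q, pfForm z c (e R (p + 1)) (e R (q + 1)) = pfTwo z c c (p + 1) (q + 1) :=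
    fun p q => pfForm_pos z c h (by omega) (by omega)
  have hp0 : ∀ p, pfForm z c (e R (p + 1)) (e R 0) = pfTwo z c c (p + 1) 0 := fun p => by
    rw [pfForm_swap, he, pfTwo_zero_right, h0]
    ring
  have hs : ∀ v, pfForm z c v v = 0 := pfForm_self z c
  induction p generalizing q with
  | zero =>
    induction q with
    | zero =>
      rw [pfForm_twistVec_rec, pfTwo_twist_rec, hl, hr, hs, hp, he, hp0, hs, hl0, hl1, hr1, hr1,
        h0', pfTwo_zero_right _ _ _ 0, h0]
      linear_combination -hd
    | succ q ih =>
      rw [pfForm_twistVec_rec, pfTwo_twist_rec, ih, hl, hl, hp, hp, he, he, hl0, hl0, hl1, hl1]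
      linear_combination -((-z) ^ (q + 1)) * hd
  | succ p ih =>
    induction q with
    | zero =>
      rw [pfForm_twistVec_rec, pfTwo_twist_rec, ih, hr, hr, hp, hp, hp0, hp0, hr1, hr1]
      ring
    | succ q ihq =>
      rw [pfForm_twistVec_rec, pfTwo_twist_rec, ih, ih, ihq, hp, hp, hp, hp]

end Form

end

noncomputable section

/-! ### Pfaffians as a linear functional on the exterior algebra. -/

section Wick

open CliffordAlgebra

variable {R V : Type*} [CommRing R] [AddCommGroup V] [Module R V]

/-- The linear function on the exterior algebra that takes `v_1 ∧ … ∧ v_n` to the pfaffian of the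
matrix with entries `B v_i v_j`. -/
def wick (B : LinearMap.BilinForm R V) (hB : ∀ v, B v v = 0) : ExteriorAlgebra R V →ₗ[R] R :=
  ExteriorAlgebra.algebraMapInv.toLinearMap ∘ₗ
    changeForm (Q := (0 : QuadraticForm R V)) (Q' := 0) (B := -B) (by ext v; simp [hB])

theorem wick_one (B : LinearMap.BilinForm R V) (hB : ∀ v, B v v = 0) : wick B hB 1 = 1 := by
  simp only [wick, LinearMap.comp_apply]
  rw [changeForm_one]
  simp

/-- This is the expansion of a pfaffian along its first row: in `changeForm_ι_mul` the term with `v`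
on the left has no scalar part, and the sign in `-B` makes the contraction positive. -/
theorem wick_ι_mul (B : LinearMap.BilinForm R V) (hB : ∀ v, B v v = 0) (v : V)
    (w : ExteriorAlgebra R V) :
    wick B hB (ExteriorAlgebra.ι R v * w) =
      wick B hB (contractLeft (Q := (0 : QuadraticForm R V)) (B v) w) := by
  simp only [wick, LinearMap.comp_apply]
  rw [ExteriorAlgebra.ι, changeForm_ι_mul, changeForm_contractLeft]
  simp only [AlgHom.toLinearMap_apply, map_sub, map_mul, LinearMap.neg_apply, map_neg]
  have h : ExteriorAlgebra.algebraMapInv (ι (0 : QuadraticForm R V) v) = 0 :=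
    (ExteriorAlgebra.lift_ι_apply R (0 : V →ₗ[R] R) (fun _ => by simp) v)
  rw [h]
  simp

/-- The wedge product of the vectors `g p`, for `p` in the list `l`. -/
def wedge (R : Type*) {V : Type*} [CommRing R] [AddCommGroup V] [Module R V] (g : ℕ → V)
    (l : List ℕ) : ExteriorAlgebra R V :=
  (l.map fun p => ExteriorAlgebra.ι R (g p)).prod

theorem wedge_nil (g : ℕ → V) : wedge R g [] = 1 := rfl

theorem wedge_cons (g : ℕ → V) (p : ℕ) (l : List ℕ) :
    wedge R g (p :: l) = ExteriorAlgebra.ι R (g p) * wedge R g l := by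
  simp [wedge]

theorem wedge_concat (g : ℕ → V) (p : ℕ) (l : List ℕ) :
    wedge R g (l ++ [p]) = (-1) ^ l.length * (ExteriorAlgebra.ι R (g p) * wedge R g l) := by
  induction l with
  | nil => simp [wedge]
  | cons q l ih =>
    rw [List.cons_append, wedge_cons, ih, wedge_cons, List.length_cons, pow_succ]
    have h := eq_neg_of_add_eq_zero_left (ExteriorAlgebra.ι_add_mul_swap (R := R) (g q) (g p))
    have hc : Commute ((-1 : ExteriorAlgebra R V) ^ l.length) (ExteriorAlgebra.ι R (g q)) :=
      (Commute.neg_one_left _).pow_left _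
    rw [← mul_assoc, ← hc.eq, mul_assoc, ← mul_assoc (ExteriorAlgebra.ι R (g q)), h]
    noncomm_ring

theorem contractLeft_wedge (d : Module.Dual R V) (g : ℕ → V) (l : List ℕ) :
    contractLeft (Q := (0 : QuadraticForm R V)) d (wedge R g l) =
      ∑ k : Fin l.length, ((-1) ^ (k : ℕ) * d (g (l.get k))) • wedge R g (l.eraseIdx k) := by
  induction l with
  | nil =>
    simp [wedge_nil]
  | cons p l ih =>
    rw [wedge_cons, ExteriorAlgebra.ι]
    refine (contractLeft_ι_mul (Q := (0 : QuadraticForm R V)) d _ _).trans ?_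
    rw [ih]
    simp only [List.length_cons]
    rw [Fin.sum_univ_succ, sub_eq_add_neg, mul_sum, ← Finset.sum_neg_distrib]
    congr 1
    · simp
    · refine Finset.sum_congr rfl fun k _ => ?_
      have hk : (p :: l).get k.succ = l.get k := rfl
      rw [hk]
      simp only [Fin.val_succ, List.eraseIdx_cons_succ, wedge_cons]
      rw [pow_succ, mul_smul_comm, ExteriorAlgebra.ι, ← neg_smul]
      congr 1
      ring

theorem wick_ι_mul_wedge (B : LinearMap.BilinForm R V) (hB : ∀ v, B v v = 0) (v : V) (g : ℕ → V)
    (l : List ℕ) : wick B hB (ExteriorAlgebra.ι R v * wedge R g l) =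
      ∑ k : Fin l.length,
        (-1) ^ (k : ℕ) * B v (g (l.get k)) * wick B hB (wedge R g (l.eraseIdx k)) := by
  rw [wick_ι_mul, contractLeft_wedge]
  simp

end Wick

/-! ### Pseudo-pfaffians as values of the Wick functional. -/

section Pf

variable {R : Type*} [CommRing R]

theorem map_pf {A : Type*} [CommRing A] (f : R →+* A) (z : R) (c : ℕ → R) (l : List ℕ) :
    f (pf z c l) = pf (f z) (fun k => f (c k)) l := by
  induction hn : l.length using Nat.strong_induction_on generalizing l with
  | _ n ih =>
    subst hn
    cases l with
    | nil => simp [pf]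
    | cons p t =>
      rw [pf, pf]
      split_ifs
      · rw [map_sum]
        refine Finset.sum_congr rfl fun k _ => ?_
        rw [map_mul, map_mul, map_pow, map_neg, map_one, ih _ _ _ rfl]
        have := k.2
        rw [List.length_eraseIdx]
        simp [this]
      · rw [map_sum]
        refine Finset.sum_congr rfl fun k _ => ?_
        rw [map_mul, map_mul, map_pow, map_neg, map_one, map_pfTwo, ih _ _ _ rfl]
        have := k.2
        rw [List.length_eraseIdx]
        simp only [this, if_true, List.length_cons]
        omega

/-- The function `wick` for the form `pfForm`, on products of `n` vectors; for `n` odd, the vector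
`star` is added in front. -/
def pfWick (z : R) (c : ℕ → R) (n : ℕ) : ExteriorAlgebra R (Option ℕ →₀ R) →ₗ[R] R :=
  wick (pfForm z c) (pfForm_self z c) ∘ₗ
    LinearMap.mulLeft R (if Odd n then ExteriorAlgebra.ι R (star R) else 1)

theorem pfWick_of_odd (z : R) (c : ℕ → R) {n : ℕ} (hn : Odd n)
    (w : ExteriorAlgebra R (Option ℕ →₀ R)) :
    pfWick z c n w = wick (pfForm z c) (pfForm_self z c) (ExteriorAlgebra.ι R (star R) * w) := by
  simp [pfWick, hn]

theorem pfWick_of_not_odd (z : R) (c : ℕ → R) {n : ℕ} (hn : ¬Odd n)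
    (w : ExteriorAlgebra R (Option ℕ →₀ R)) :
    pfWick z c n w = wick (pfForm z c) (pfForm_self z c) w := by
  simp [pfWick, hn]

/-- The two cases in the definition of `pf` are first-row expansions, along `star` for odd length
and along the first vector for even length. The series `b` may differ from the `c` of the form,
which allows `g` to be either `e` or `twistVec`. -/
theorem pfWick_wedge (z : R) (c b : ℕ → R) (g : ℕ → Option ℕ →₀ R)
    (hg : ∀ p q, 0 < p → 0 < q → pfForm z c (g p) (g q) = pfTwo z b b p q)
    (hs : ∀ p, 0 < p → pfForm z c (star R) (g p) = b p) (l : List ℕ) (hl : ∀ p ∈ l, 0 < p) :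
    pfWick z c l.length (wedge R g l) = pf z b l := by
  induction hn : l.length using Nat.strong_induction_on generalizing l with
  | _ n ih =>
    subst hn
    cases l with
    | nil => rw [pfWick_of_not_odd _ _ (by simp), wedge_nil, wick_one, pf]
    | cons p t =>
      rw [pf, List.length_cons]
      split_ifs with h
      · rw [pfWick_of_odd _ _ h, wick_ι_mul_wedge]
        refine Finset.sum_congr rfl fun k _ => ?_
        have hk := k.2
        have hlen : ((p :: t).eraseIdx k).length = t.length := by
          rw [List.length_eraseIdx, if_pos hk, List.length_cons, Nat.add_sub_cancel]
        rw [hs _ (hl _ (List.get_mem _ _)), ← ih _ (by simp) _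
          (fun q hq => hl q (List.mem_of_mem_eraseIdx hq)) hlen,
          pfWick_of_not_odd _ _ (by simpa [Nat.odd_add_one] using h)]
      · rw [pfWick_of_not_odd _ _ h, wedge_cons, wick_ι_mul_wedge]
        refine Finset.sum_congr rfl fun k _ => ?_
        have hk := k.2
        have hlen : (t.eraseIdx k).length = t.length - 1 := by
          rw [List.length_eraseIdx]
          simp
        rw [hg _ _ (hl _ (by simp)) (hl _ (List.mem_cons_of_mem _ (List.get_mem _ _))),
          ← ih _ (by simp) _
          (fun q hq => hl q (List.mem_cons_of_mem _ (List.mem_of_mem_eraseIdx hq))) hlen,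
          pfWick_of_not_odd]
        rw [Nat.not_odd_iff] at h ⊢
        omega

/-- Against vectors of positive index, `e_0` acts as `-star`; this is why a part `0` does the work
of the auxiliary vector. -/
theorem pfForm_star_add_e_zero (z : R) (c : ℕ → R) (h0 : c 0 = 1) {p : ℕ} (hp : 0 < p) :
    pfForm z c (star R + e R 0) (e R p) = 0 := by
  simp [pfForm_star_e, pfForm_e_zero z c h0 hp]

theorem contractLeft_star_add_e_zero (z : R) (c : ℕ → R) (h0 : c 0 = 1) (l : List ℕ)
    (hl : ∀ p ∈ l, 0 < p) :
    CliffordAlgebra.contractLeft (Q := (0 : QuadraticForm R (Option ℕ →₀ R)))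
      (pfForm z c (star R + e R 0)) (wedge R (e R) l) = 0 := by
  rw [contractLeft_wedge]
  refine Finset.sum_eq_zero fun k _ => ?_
  rw [pfForm_star_add_e_zero z c h0 (hl _ (List.get_mem _ _))]
  simp

/-- A part `0` at the end can be dropped. -/
theorem pfWick_concat_zero (z : R) (c : ℕ → R) (h0 : c 0 = 1) (l : List ℕ)
    (hl : ∀ p ∈ l, 0 < p) :
    pfWick z c (l.length + 1) (wedge R (e R) (l ++ [0])) =
      pfWick z c l.length (wedge R (e R) l) := by
  have he : ExteriorAlgebra.ι R (e R 0) =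
      ExteriorAlgebra.ι R (star R + e R 0) - ExteriorAlgebra.ι R (star R) := by
    rw [map_add, add_sub_cancel_left]
  have hc := contractLeft_star_add_e_zero z c h0 l hl
  rw [wedge_concat, he]
  by_cases h : Odd l.length
  · rw [pfWick_of_odd _ _ h, pfWick_of_not_odd _ _ (by simpa [Nat.odd_add_one] using h),
      h.neg_one_pow, sub_mul, neg_one_mul, map_neg, map_sub, wick_ι_mul, hc]
    simp
  -- For even length both `star` and `e_0` occur. The vector `star + e_0` pairs only with `star`,
  -- and the value `-1` cancels the sign from swapping the two.
  · have hs : pfForm z c (star R + e R 0) (star R) = -1 := by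
      rw [pfForm_swap, map_add, pfForm_self, pfForm_star_e, h0, zero_add]
    rw [pfWick_of_not_odd _ _ h, pfWick_of_odd _ _ (by simpa [Nat.odd_add_one] using h),
      (Nat.not_odd_iff_even.1 h).neg_one_pow, one_mul, sub_mul, mul_sub, ← mul_assoc, ← mul_assoc,
      ExteriorAlgebra.ι_sq_zero, zero_mul, sub_zero,
      eq_neg_of_add_eq_zero_left (ExteriorAlgebra.ι_add_mul_swap (R := R) (star R) _), neg_mul,
      mul_assoc, map_neg, wick_ι_mul, ExteriorAlgebra.ι, CliffordAlgebra.contractLeft_ι_mul, hc, hs]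
    simp

end Pf

end

noncomputable section

/-! ### Row reduction and expansion over interlacing sequences. -/

section Expansion

variable {R : Type*} [CommRing R]

theorem twistVec_eq (u d : R) {p q : ℕ} (h : q ≤ p) :
    twistVec u d p = e R p + d • ∑ a ∈ Ico q p, u ^ (p - 1 - a) • e R a - u ^ (p - q) • e R q +
      u ^ (p - q) • twistVec u d q := by
  induction p, h using Nat.le_induction with
  | base => simp
  | succ p hp ih =>
    have h1 : ∑ a ∈ Ico q (p + 1), u ^ (p + 1 - 1 - a) • e R a =
        u • (∑ a ∈ Ico q p, u ^ (p - 1 - a) • e R a) + e R p := by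
      rw [Finset.sum_Ico_succ_top hp, Finset.smul_sum]
      congr 1
      · refine Finset.sum_congr rfl fun a ha => ?_
        rw [Finset.mem_Ico] at ha
        rw [smul_smul, ← pow_succ', show p + 1 - 1 - a = p - 1 - a + 1 by omega]
      · simp
    rw [h1, twistVec, show p + 1 - q = p - q + 1 by omega]
    conv_lhs => rw [ih]
    rw [pow_succ]
    module

/-- The weight of the row of a border strip which has the contents from `a` to `p - 1`, where `q`
is the part below `p`. -/
def rowWeight (u d : R) (p q a : ℕ) : R :=
  if a = p then 1 else (if a = q ∧ 0 < q then d - u else d) * u ^ (p - 1 - a)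

/-- The row vector obtained from `twistVec u d p` by clearing the terms below `q`. -/
def rowVec (u d : R) (p q : ℕ) : Option ℕ →₀ R := ∑ a ∈ Icc q p, rowWeight u d p q a • e R a

theorem rowVec_eq (u d : R) {p q : ℕ} (h : q < p) :
    rowVec u d p q = e R p + d • ∑ a ∈ Ico q p, u ^ (p - 1 - a) • e R a -
      if 0 < q then u ^ (p - q) • e R q else 0 := by
  have h1 : ∀ a ∈ Ico q p, rowWeight u d p q a • e R a = d • u ^ (p - 1 - a) • e R a -
      if a = q then (if 0 < q then u ^ (p - q) • e R q else 0) else 0 := by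
    intro a ha
    rw [Finset.mem_Ico] at ha
    rw [rowWeight, if_neg (by omega)]
    by_cases haq : a = q
    · subst haq
      by_cases h0 : 0 < a
      -- Here `d u^{p-1-q} - u^{p-q} = (d - u) u^{p-1-q}`, the source of the factor `d - u`.
      · simp only [h0, and_self, if_true]
        rw [show p - a = p - 1 - a + 1 by omega, pow_succ]
        module
      · simp only [h0, and_false, if_true, if_false]
        module
    · simp only [haq, false_and, if_false]
      module
  rw [rowVec, ← Finset.Ico_insert_right h.le, Finset.sum_insert (by simp),
    Finset.sum_congr rfl h1, Finset.sum_sub_distrib, Finset.smul_sum, Finset.sum_ite_eq',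
    if_pos (by simp [h])]
  simp [rowWeight, add_sub_assoc]

/-- Each factor differs from its `rowVec` by a multiple of the next `twistVec`, which squares to
zero in the product. For the last factor there is nothing to subtract: the `e_0` terms in
`twistVec_eq` cancel. -/
theorem wedge_twistVec (u d : R) (l : List ℕ) (hl : l.Pairwise (· > ·)) (h0 : ∀ p ∈ l, 0 < p) :
    wedge R (twistVec u d) l = (List.ofFn fun i : Fin l.length =>
      ExteriorAlgebra.ι R (rowVec u d (l.getD i 0) (l.getD (i + 1) 0))).prod := by
  induction l with
  | nil => simp [wedge]
  | cons p t ih =>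
    have ih' := ih hl.of_cons fun q hq => h0 q (List.mem_cons_of_mem _ hq)
    simp only [List.length_cons]
    rw [List.ofFn_succ, List.prod_cons]
    simp only [Fin.val_zero, Fin.val_succ, List.getD_cons_zero, List.getD_cons_succ]
    rw [← ih', wedge_cons]
    have hp := h0 p (by simp)
    cases t with
    | nil =>
      rw [twistVec_eq u d (Nat.zero_le p), List.getD_nil, rowVec_eq u d hp]
      simp [twistVec]
    | cons q t =>
      have hq := h0 q (by simp)
      have hqp : q < p := List.rel_of_pairwise_cons hl (by simp)
      rw [twistVec_eq u d hqp.le, List.getD_cons_zero, rowVec_eq u d hqp, if_pos hq, wedge_cons,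
        map_add, map_smul _ _ (twistVec u d q), add_mul, smul_mul_assoc,
        ← mul_assoc (ExteriorAlgebra.ι R (twistVec u d q)), ExteriorAlgebra.ι_sq_zero, zero_mul,
        smul_zero, add_zero]

/-- The sequences of the lengths of the rows that are left when a border strip is removed from the
diagram of the strict partition `l`. -/
def interlacing (l : List ℕ) : Finset (Fin l.length → ℕ) :=
  {a ∈ Fintype.piFinset fun i : Fin l.length => Icc (l.getD (i + 1) 0) (l.getD i 0) | StrictAnti a}

theorem getD_antitone {l : List ℕ} (hl : l.Pairwise (· > ·)) : Antitone fun i => l.getD i 0 := by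
  refine antitone_nat_of_succ_le fun i => ?_
  by_cases h : i + 1 < l.length
  · rw [List.getD_eq_getElem _ _ h, List.getD_eq_getElem _ _ (by omega)]
    exact (List.pairwise_iff_getElem.1 hl i (i + 1) (by omega) h (by omega)).le
  · rw [List.getD_eq_default _ _ (by omega)]
    exact Nat.zero_le _

theorem wedge_twistVec_eq_sum (u d : R) (l : List ℕ) (hl : l.Pairwise (· > ·))
    (h0 : ∀ p ∈ l, 0 < p) : wedge R (twistVec u d) l =
      ∑ a ∈ interlacing l, (∏ i : Fin l.length, rowWeight u d (l.getD i 0) (l.getD (i + 1) 0) (a i)) •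
        wedge R (e R) (List.ofFn a) := by
  rw [wedge_twistVec u d l hl h0, ← ExteriorAlgebra.ιMulti_apply]
  simp only [rowVec]
  rw [← AlternatingMap.coe_multilinearMap, MultilinearMap.map_sum_finset, interlacing,
    Finset.sum_filter_of_ne]
  · refine Finset.sum_congr rfl fun a _ => ?_
    rw [MultilinearMap.map_smul_univ, AlternatingMap.coe_multilinearMap,
      ExteriorAlgebra.ιMulti_apply, wedge, List.map_ofFn]
    rfl
  · intro a ha hne
    rw [Fintype.mem_piFinset] at ha
    simp only [Finset.mem_Icc] at ha
    -- The intervals `[λ_{i+1}, λ_i]` meet at most in endpoints, so every choice is weakly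
    -- decreasing; a repeated value kills the wedge product.
    have hanti : Antitone a := by
      intro i j hij
      rcases hij.eq_or_lt with rfl | hij
      · exact le_rfl
      · exact (ha j).2.trans ((getD_antitone hl (show (i : ℕ) + 1 ≤ j from hij)).trans (ha i).1)
    refine hanti.strictAnti_of_injective fun i j hij => ?_
    by_contra hc
    refine hne ?_
    have h : wedge R (e R) (List.ofFn a) =
        ExteriorAlgebra.ιMulti R l.length fun i => e R (a i) := by
      rw [ExteriorAlgebra.ιMulti_apply, wedge, List.map_ofFn]
      rfl
    rw [h, AlternatingMap.map_eq_zero_of_eq _ _ (by rw [hij]) hc, smul_zero]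

theorem filter_pos_eq_or {s : List ℕ} (hs : s.Pairwise (· > ·)) :
    s = s.filter (0 < ·) ∨ s = s.filter (0 < ·) ++ [0] := by
  induction s with
  | nil => simp
  | cons p t ih =>
    by_cases hp : 0 < p
    · rw [List.filter_cons_of_pos (by simpa using hp)]
      simpa using ih hs.of_cons
    · have ht : t = [] := List.eq_nil_iff_forall_not_mem.2 fun q hq => by
        have := List.rel_of_pairwise_cons hs hq
        omega
      obtain rfl : p = 0 := by omega
      simp [ht]

theorem pfWick_wedge_e (z : R) (c : ℕ → R) (h0 : c 0 = 1) (h : ∀ p, 0 < p → pfTwo z c c p p = 0)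
    {s : List ℕ} (hs : s.Pairwise (· > ·)) :
    pfWick z c s.length (wedge R (e R) s) = pf z c (s.filter (0 < ·)) := by
  have hpos : ∀ p ∈ s.filter (0 < ·), 0 < p := fun p hp => by simpa using (List.mem_filter.1 hp).2
  have key := pfWick_wedge z c c (e R) (fun p q => pfForm_pos z c h)
    (fun p _ => pfForm_star_e z c p) _ hpos
  rcases filter_pos_eq_or hs with hf | hf
  · rw [← key, ← hf]
  · rw [← key, ← pfWick_concat_zero z c h0 _ hpos]
    conv_lhs => rw [hf]
    simp

/-- The pseudo-pfaffians of the Chern series `c (1 + (d - u) t) / (1 - u t)`. -/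
theorem pf_twist (z u d : R) (hd : d * (d - 2 * u - z) = 0) (c : ℕ → R) (h0 : c 0 = 1)
    (h : ∀ p, 0 < p → pfTwo z c c p p = 0) (l : List ℕ) (hl : l.Pairwise (· > ·))
    (hpos : ∀ p ∈ l, 0 < p) : pf z (twist u d c) l =
      ∑ a ∈ interlacing l, (∏ i : Fin l.length, rowWeight u d (l.getD i 0) (l.getD (i + 1) 0) (a i)) *
        pf z c ((List.ofFn a).filter (0 < ·)) := by
  have hg : ∀ p q, 0 < p → 0 < q → pfForm z c (twistVec u d p) (twistVec u d q) =
      pfTwo z (twist u d c) (twist u d c) p q := by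
    intro p q hp hq
    obtain ⟨p, rfl⟩ := Nat.exists_eq_succ_of_ne_zero hp.ne'
    obtain ⟨q, rfl⟩ := Nat.exists_eq_succ_of_ne_zero hq.ne'
    exact pfForm_twistVec z u d hd c h0 h p q
  rw [← pfWick_wedge z c _ (twistVec u d) hg (fun p _ => pfForm_star_twistVec z u d c p) l hpos,
    wedge_twistVec_eq_sum u d l hl hpos, map_sum]
  refine Finset.sum_congr rfl fun a ha => ?_
  have ha' : StrictAnti a := (Finset.mem_filter.1 ha).2
  rw [map_smul, smul_eq_mul, ← pfWick_wedge_e z c h0 h (List.pairwise_ofFn.2 fun i j hij => ha' hij)]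
  simp

end Expansion

end

/-! ### Counting the components of a border strip. -/

section Components

variable {S : Finset (ℕ × ℕ)}

/-- The content of a box. -/
def content (b : ℕ × ℕ) : ℤ := (b.2 : ℤ) - b.1

/-- The boxes of `S` with no box of `S` on the left or below. -/
def ends (S : Finset (ℕ × ℕ)) : Finset (ℕ × ℕ) :=
  S \ ({b ∈ S | (b.1 + 1, b.2) ∈ S} ∪ {b ∈ S | (b.1, b.2 + 1) ∈ S}.image fun b => (b.1, b.2 + 1))

theorem mem_ends {b : ℕ × ℕ} : b ∈ ends S ↔
    b ∈ S ∧ (b.1 + 1, b.2) ∉ S ∧ ∀ a ∈ S, (a.1, a.2 + 1) ≠ b := by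
  simp only [ends, mem_sdiff, mem_union, mem_filter, mem_image, not_or, not_and, not_exists]
  constructor
  · rintro ⟨h, h1, h2⟩
    exact ⟨h, h1 h, fun a ha hab => h2 a ⟨ha, hab ▸ h⟩ hab⟩
  · rintro ⟨h, h1, h2⟩
    exact ⟨h, fun _ => h1, fun a ha hab => h2 a ha.1 hab⟩

/-- A box that is not an end has a neighbour below or on the left, never both, so it accounts for
exactly one line. -/
theorem card_ends (hS : ∀ a ∈ S, ∀ b ∈ S, a.1 + b.2 = b.1 + a.2 → a = b) :
    #(ends S) + hLines S + vLines S = #S := by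
  have hv : #({b ∈ S | (b.1, b.2 + 1) ∈ S}.image fun b => (b.1, b.2 + 1)) = vLines S := by
    refine Finset.card_image_of_injective _ fun a b hab => ?_
    simp only [Prod.mk.injEq, Nat.add_right_cancel_iff] at hab
    exact Prod.ext hab.1 hab.2
  have hdis : Disjoint {b ∈ S | (b.1 + 1, b.2) ∈ S}
      ({b ∈ S | (b.1, b.2 + 1) ∈ S}.image fun b => (b.1, b.2 + 1)) := by
    rw [Finset.disjoint_left]
    intro b hb hb'
    obtain ⟨a, ha, rfl⟩ := Finset.mem_image.1 hb'
    -- The left neighbour and the lower neighbour of a box lie on the same diagonal.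
    have h := hS a (Finset.mem_filter.1 ha).1 _ (Finset.mem_filter.1 hb).2
      (by simp only; omega)
    have := congrArg Prod.fst h
    simp only at this
    omega
  have hsub : {b ∈ S | (b.1 + 1, b.2) ∈ S} ∪
      {b ∈ S | (b.1, b.2 + 1) ∈ S}.image (fun b => (b.1, b.2 + 1)) ⊆ S := by
    refine Finset.union_subset (Finset.filter_subset _ _) fun b hb => ?_
    obtain ⟨a, ha, rfl⟩ := Finset.mem_image.1 hb
    exact (Finset.mem_filter.1 ha).2
  have h := Finset.card_sdiff_add_card_eq_card hsub
  rw [Finset.card_union_of_disjoint hdis, hv] at h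
  rw [ends, hLines, add_assoc]
  exact h

theorem boxGraph_adj_cases {a b : ℕ × ℕ} (ha : a ∈ S) (hb : b ∈ S) (h : boxGraph.Adj a b) :
    content b = content a + 1 ∧ b ∉ ends S ∨ content a = content b + 1 ∧ a ∉ ends S := by
  have key : ∀ a ∈ S, ∀ b ∈ S, b = (a.1, a.2 + 1) ∨ b = (a.1 + 1, a.2) →
      content b = content a + 1 ∧ b ∉ ends S ∨ content a = content b + 1 ∧ a ∉ ends S := by
    rintro a ha b hb (rfl | rfl)
    · refine Or.inl ⟨by simp [content]; ring, fun h => (mem_ends.1 h).2.2 a ha rfl⟩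
    · exact Or.inr ⟨by simp [content]; ring, fun h => (mem_ends.1 h).2.1 hb⟩
  rcases ((SimpleGraph.fromRel_adj _ _ _).1 h).2 with h | h
  · exact key a ha b hb h
  · exact (key b hb a ha h).symm

/-- In a set with at most one box on each diagonal, each connected component has exactly one end. -/
theorem numComponents_eq (hS : ∀ a ∈ S, ∀ b ∈ S, a.1 + b.2 = b.1 + a.2 → a = b) :
    numComponents S = #(ends S) := by
  have hc : ∀ a ∈ S, ∀ b ∈ S, content a = content b → a = b := fun a ha b hb h =>
    hS a ha b hb (by simp only [content] at h; omega)
  have hsub : ∀ r ∈ ends S, r ∈ S := fun r hr => (mem_ends.1 hr).1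
  -- The set of ends of content at most that of a given box is constant along edges, hence on
  -- components; it separates distinct ends.
  have hstep : ∀ a ∈ S, ∀ b ∈ S, content b = content a + 1 → b ∉ ends S →
      {r ∈ ends S | content r ≤ content a} = {r ∈ ends S | content r ≤ content b} := by
    intro a ha b hb hab hbe
    refine Finset.filter_congr fun r hr => ⟨fun h => by omega, fun h => ?_⟩
    by_contra hlt
    refine hbe ?_
    rwa [← hc r (hsub r hr) b hb (by omega)]
  have hreach : ∀ a b : (S : Set (ℕ × ℕ)), (boxGraph.induce (S : Set (ℕ × ℕ))).Reachable a b →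
      {r ∈ ends S | content r ≤ content a} = {r ∈ ends S | content r ≤ content b} := by
    rintro a b ⟨w⟩
    induction w with
    | nil => rfl
    | @cons a b c hadj _ ih =>
      rw [← ih]
      rcases boxGraph_adj_cases a.2 b.2 hadj with ⟨h1, h2⟩ | ⟨h1, h2⟩
      · exact hstep a a.2 b b.2 h1 h2
      · exact (hstep b b.2 a a.2 h1 h2).symm
  rw [numComponents, ← Nat.card_eq_finsetCard]
  refine (Nat.card_eq_of_bijective (fun r : ends S =>
    (boxGraph.induce (S : Set (ℕ × ℕ))).connectedComponentMk ⟨r, hsub r r.2⟩) ⟨?_, ?_⟩).symm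
  · intro r s hrs
    have h := hreach _ _ (SimpleGraph.ConnectedComponent.eq.1 hrs)
    simp only [Finset.ext_iff, Finset.mem_filter] at h
    have h1 := ((h r).1 ⟨r.2, le_rfl⟩).2
    have h2 := ((h s).2 ⟨s.2, le_rfl⟩).2
    exact Subtype.ext (hc r (hsub r r.2) s (hsub s s.2) (le_antisymm h1 h2))
  · intro C
    classical
    obtain ⟨b, hb⟩ := C.nonempty_supp
    -- The box of least content in a component is an end, since moving left or down lowers the
    -- content.
    obtain ⟨m, hm, hmin⟩ := Finset.exists_min_image
      {a : (S : Set (ℕ × ℕ)) | (boxGraph.induce (S : Set (ℕ × ℕ))).connectedComponentMk a = C}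
      (fun a => content a) ⟨b, by simpa using hb⟩
    simp only [Finset.mem_filter, Finset.mem_univ, true_and] at hm hmin
    have hadj : ∀ a : (S : Set (ℕ × ℕ)), boxGraph.Adj a m → content m ≤ content a := by
      intro a h
      refine hmin a ?_
      rw [← hm, SimpleGraph.ConnectedComponent.eq]
      exact SimpleGraph.Adj.reachable (by exact h)
    refine ⟨⟨m, mem_ends.2 ⟨m.2, fun h => ?_, fun a ha h => ?_⟩⟩, hm⟩
    · have := hadj ⟨_, h⟩ ((SimpleGraph.fromRel_adj _ _ _).2
        ⟨by simp [Prod.ext_iff], by simp⟩)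
      simp only [content] at this
      omega
    · have := hadj ⟨a, ha⟩ ((SimpleGraph.fromRel_adj _ _ _).2
        ⟨by rw [← h]; simp [Prod.ext_iff], by simp [← h]⟩)
      simp only [← h, content] at this
      omega

theorem numComponents_add (hS : ∀ a ∈ S, ∀ b ∈ S, a.1 + b.2 = b.1 + a.2 → a = b) :
    numComponents S + hLines S + vLines S = #S := by
  rw [numComponents_eq hS, card_ends hS]

end Components

/-! ### Border strips as interlacing sequences, and their weights. -/

namespace StrictPartition

theorem ext_getD {l m : StrictPartition} (h : ∀ i, l.parts.getD i 0 = m.parts.getD i 0) :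
    l = m := by
  refine diagram_injective (Finset.ext fun ⟨i, j⟩ => ?_)
  rw [mem_diagram, mem_diagram, h]

theorem getD_succ_lt (l : StrictPartition) {i : ℕ} (h : 0 < l.parts.getD i 0) :
    l.parts.getD (i + 1) 0 < l.parts.getD i 0 := by
  by_cases hi : i + 1 < l.parts.length
  · rw [List.getD_eq_getElem _ _ hi, List.getD_eq_getElem _ _ (by omega)]
    exact List.pairwise_iff_getElem.1 l.decreasing i (i + 1) (by omega) hi (by omega)
  · rwa [List.getD_eq_default _ _ (by omega)]

theorem getD_pos (l : StrictPartition) {i : ℕ} (h : i < l.parts.length) :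
    0 < l.parts.getD i 0 := by
  rw [List.getD_eq_getElem _ _ h]
  exact l.pos _ (List.getElem_mem h)

/-- In a shifted diagram the contents of row `i` of `l/m` run from `m_i` to `l_i - 1`; interlacing
says that these ranges are disjoint for different rows. -/
theorem isBorderStrip_iff (l m : StrictPartition) : IsBorderStrip l m ↔
    ∀ i, l.parts.getD (i + 1) 0 ≤ m.parts.getD i 0 ∧ m.parts.getD i 0 ≤ l.parts.getD i 0 := by
  have hm := getD_antitone m.decreasing
  have hl := getD_antitone l.decreasing
  constructor
  · rintro ⟨h1, h2⟩
    have hle : ∀ i, m.parts.getD i 0 ≤ l.parts.getD i 0 := by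
      intro i
      by_contra hc
      have h := h1 ((mem_diagram m i (i + l.parts.getD i 0)).2 ⟨by omega, by omega⟩)
      rw [mem_diagram] at h
      omega
    refine fun i => ⟨?_, hle i⟩
    by_contra hc
    have hm1 : m.parts.getD (i + 1) 0 ≤ m.parts.getD i 0 := hm (Nat.le_succ i)
    have hl1 : l.parts.getD (i + 1) 0 ≤ l.parts.getD i 0 := hl (Nat.le_succ i)
    have h := h2 (i, i + m.parts.getD i 0)
      (Finset.mem_sdiff.2 ⟨(mem_diagram _ _ _).2 ⟨by omega, by omega⟩, fun h => by
        rw [mem_diagram] at h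
        omega⟩)
      (i + 1, i + 1 + m.parts.getD i 0)
      (Finset.mem_sdiff.2 ⟨(mem_diagram _ _ _).2 ⟨by omega, by omega⟩, fun h => by
        rw [mem_diagram] at h
        omega⟩) (by simp only; omega)
    simp at h
  · intro h
    refine ⟨?_, ?_⟩
    · rintro ⟨i, j⟩ hij
      rw [mem_diagram] at hij ⊢
      have := (h i).2
      omega
    · have key : ∀ i j i' j', (i, j) ∈ skew l m → (i', j') ∈ skew l m → i + j' = i' + j →
          ¬i < i' := by
        intro i j i' j' h1 h2 h3 hlt
        rw [skew, Finset.mem_sdiff, mem_diagram, mem_diagram] at h1 h2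
        have h4 := (h i).1
        have h5 : l.parts.getD i' 0 ≤ l.parts.getD (i + 1) 0 := hl hlt
        omega
      rintro ⟨i, j⟩ h1 ⟨i', j'⟩ h2 h3
      simp only at h3
      have h4 := key i j i' j' h1 h2 h3
      have h5 := key i' j' i j h2 h1 h3.symm
      rw [Prod.mk.injEq]
      omega

variable {l m : StrictPartition}

theorem mem_skew (l m : StrictPartition) (i j : ℕ) :
    (i, j) ∈ l.skew m ↔ i + m.parts.getD i 0 ≤ j ∧ j < i + l.parts.getD i 0 := by
  rw [skew, Finset.mem_sdiff, mem_diagram, mem_diagram]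
  omega

theorem card_filter_skew (l m : StrictPartition) (P : ℕ × ℕ → Prop) [DecidablePred P]
    (r : ℕ → Finset ℕ) (hr : ∀ i j, j ∈ r i ↔ (i, j) ∈ l.skew m ∧ P (i, j)) :
    #{b ∈ l.skew m | P b} = ∑ i ∈ range l.parts.length, #(r i) := by
  rw [Finset.card_eq_sum_card_fiberwise (f := Prod.fst) (t := range l.parts.length)]
  · refine Finset.sum_congr rfl fun i _ => ?_
    have h : {b ∈ {b ∈ l.skew m | P b} | b.1 = i} = (r i).image fun j => (i, j) := by
      ext ⟨i', j⟩
      simp only [Finset.mem_filter, Finset.mem_image, Prod.mk.injEq, hr]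
      constructor
      · rintro ⟨h, rfl⟩
        exact ⟨j, h, rfl, rfl⟩
      · rintro ⟨j', h, rfl, rfl⟩
        exact ⟨h, rfl⟩
    rw [h]
    exact Finset.card_image_of_injective _ fun a b hab => (Prod.mk.inj hab).2
  · rintro ⟨i, j⟩ hb
    have h := ((mem_skew l m i j).1 (Finset.mem_filter.1 hb).1)
    rw [Finset.coe_range, Set.mem_Iio]
    by_contra hc
    rw [List.getD_eq_default l.parts _ (by simpa using hc)] at h
    omega

theorem card_skew (l m : StrictPartition) : #(l.skew m) =
    ∑ i ∈ range l.parts.length, (l.parts.getD i 0 - m.parts.getD i 0) := by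
  have h := card_filter_skew l m (fun _ => True)
    (fun i => Ico (i + m.parts.getD i 0) (i + l.parts.getD i 0)) (fun i j => by
      rw [Finset.mem_Ico, mem_skew, and_true])
  rw [Finset.filter_true] at h
  rw [h]
  refine Finset.sum_congr rfl fun i _ => ?_
  rw [Nat.card_Ico]
  omega

theorem vLines_skew (l m : StrictPartition) : vLines (l.skew m) =
    ∑ i ∈ range l.parts.length, (l.parts.getD i 0 - m.parts.getD i 0 - 1) := by
  have h := card_filter_skew l m (fun b => (b.1, b.2 + 1) ∈ l.skew m)
    (fun i => Ico (i + m.parts.getD i 0) (i + l.parts.getD i 0 - 1)) (fun i j => by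
      rw [Finset.mem_Ico, mem_skew]
      dsimp only
      rw [mem_skew]
      omega)
  rw [vLines, h]
  refine Finset.sum_congr rfl fun i _ => ?_
  rw [Nat.card_Ico]
  omega

/-- Only the first box of row `i` can have a box below it, namely the last box of row `i + 1` of
`l`. When `m_i = l_{i+1} > 0` that box is removed, since `m_{i+1} < m_i`. -/
theorem hLines_skew (h : IsBorderStrip l m) : hLines (l.skew m) =
    ∑ i ∈ range l.parts.length, if m.parts.getD i 0 = l.parts.getD (i + 1) 0 ∧
      0 < l.parts.getD (i + 1) 0 then 1 else 0 := by
  rw [isBorderStrip_iff] at h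
  have h := card_filter_skew l m (fun b => (b.1 + 1, b.2) ∈ l.skew m)
    (fun i => if m.parts.getD i 0 = l.parts.getD (i + 1) 0 ∧ 0 < l.parts.getD (i + 1) 0 then
      {i + m.parts.getD i 0} else ∅) (fun i j => by
      have h1 := h i
      have h2 := h (i + 1)
      have h3 := m.getD_succ_lt (i := i)
      have h4 := l.getD_succ_lt (i := i)
      rw [mem_skew]
      dsimp only
      rw [mem_skew]
      split_ifs with hi
      · rw [Finset.mem_singleton]
        omega
      · simp only [Finset.notMem_empty, false_iff]
        omega)
  rw [hLines, h]
  refine Finset.sum_congr rfl fun i _ => ?_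
  split_ifs <;> simp

variable {R : Type*} [CommRing R]

theorem prod_rowWeight (u d : R) (h : IsBorderStrip l m) :
    ∏ i ∈ range l.parts.length,
        rowWeight u d (l.parts.getD i 0) (l.parts.getD (i + 1) 0) (m.parts.getD i 0) =
      (d - u) ^ hLines (l.skew m) * u ^ vLines (l.skew m) * d ^ numComponents (l.skew m) := by
  have hi := (isBorderStrip_iff l m).1 h
  -- A row contributes a component exactly when it is nonempty and its first box has no box below.
  let k : ℕ → ℕ := fun i => if m.parts.getD i 0 = l.parts.getD i 0 ∨
    m.parts.getD i 0 = l.parts.getD (i + 1) 0 ∧ 0 < l.parts.getD (i + 1) 0 then 0 else 1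
  have hk : numComponents (l.skew m) = ∑ i ∈ range l.parts.length, k i := by
    have h1 := numComponents_add h.2
    rw [hLines_skew h, vLines_skew, card_skew, add_assoc, ← Finset.sum_add_distrib] at h1
    have h2 : ∑ i ∈ range l.parts.length, (l.parts.getD i 0 - m.parts.getD i 0) =
        ∑ i ∈ range l.parts.length, k i + ∑ i ∈ range l.parts.length,
          ((if m.parts.getD i 0 = l.parts.getD (i + 1) 0 ∧ 0 < l.parts.getD (i + 1) 0 then 1 else 0)
            + (l.parts.getD i 0 - m.parts.getD i 0 - 1)) := by
      rw [← Finset.sum_add_distrib]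
      refine Finset.sum_congr rfl fun i _ => ?_
      have h3 := hi i
      have h4 := l.getD_succ_lt (i := i)
      simp only [k]
      split_ifs <;> omega
    omega
  rw [hk, hLines_skew h, vLines_skew, ← Finset.prod_pow_eq_pow_sum, ← Finset.prod_pow_eq_pow_sum,
    ← Finset.prod_pow_eq_pow_sum, ← Finset.prod_mul_distrib, ← Finset.prod_mul_distrib]
  refine Finset.prod_congr rfl fun i _ => ?_
  have h3 := hi i
  have h4 := l.getD_succ_lt (i := i)
  rw [rowWeight, show l.parts.getD i 0 - 1 - m.parts.getD i 0 =
    l.parts.getD i 0 - m.parts.getD i 0 - 1 by omega]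
  simp only [k]
  by_cases h5 : m.parts.getD i 0 = l.parts.getD i 0
  · rw [if_pos h5, if_neg (by omega), if_pos (Or.inl h5), h5]
    simp
  · rw [if_neg h5]
    by_cases h6 : m.parts.getD i 0 = l.parts.getD (i + 1) 0 ∧ 0 < l.parts.getD (i + 1) 0
    · rw [if_pos h6, if_pos h6, if_pos (Or.inr h6)]
      ring
    · rw [if_neg h6, if_neg h6, if_neg (by tauto)]
      ring

/-- The strict partition with the positive terms of a decreasing sequence. -/
def ofStrictAnti {n : ℕ} (a : Fin n → ℕ) (ha : StrictAnti a) : StrictPartition where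
  parts := (List.ofFn a).filter (0 < ·)
  decreasing := by
    have h : (List.ofFn a).Pairwise (· > ·) := List.pairwise_ofFn.2 fun _ _ hij => ha hij
    exact h.filter _
  pos p hp := by simpa using (List.mem_filter.1 hp).2

theorem ofStrictAnti_getD {n : ℕ} (a : Fin n → ℕ) (ha : StrictAnti a) (i : ℕ) :
    (ofStrictAnti a ha).parts.getD i 0 = if h : i < n then a ⟨i, h⟩ else 0 := by
  have hs : (List.ofFn a).Pairwise (· > ·) := List.pairwise_ofFn.2 fun _ _ hij => ha hij
  have h : (ofStrictAnti a ha).parts.getD i 0 = (List.ofFn a).getD i 0 := by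
    change ((List.ofFn a).filter (0 < ·)).getD i 0 = _
    rcases filter_pos_eq_or hs with hf | hf
    · rw [← hf]
    · conv_rhs => rw [hf]
      rcases Nat.lt_or_ge i ((List.ofFn a).filter (0 < ·)).length with hi | hi
      · rw [List.getD_append _ _ _ _ hi]
      · rw [List.getD_append_right _ _ _ _ hi, List.getD_eq_default _ _ hi]
        cases i - ((List.ofFn a).filter (0 < ·)).length <;> simp
  rw [h]
  split_ifs with hi
  · rw [List.getD_eq_getElem _ _ (by simpa using hi)]
    simp
  · rw [List.getD_eq_default _ _ (by simpa using hi)]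

/-- Removing border strips from `l` amounts to choosing an interlacing sequence. -/
theorem sum_interlacing {M : Type*} [AddCommMonoid M] (l : StrictPartition)
    (f : (Fin l.parts.length → ℕ) → M) (g : StrictPartition → M)
    (hfg : ∀ (a : Fin l.parts.length → ℕ) (ha : StrictAnti a), ofStrictAnti a ha ∈ l.removals →
      f a = g (ofStrictAnti a ha)) :
    ∑ a ∈ interlacing l.parts, f a = ∑ m ∈ l.removals, g m := by
  have hmem : ∀ a ∈ interlacing l.parts, StrictAnti a ∧ ∀ i : Fin l.parts.length,
      l.parts.getD (i + 1) 0 ≤ a i ∧ a i ≤ l.parts.getD i 0 := by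
    intro a ha
    rw [interlacing, Finset.mem_filter, Fintype.mem_piFinset] at ha
    exact ⟨ha.2, fun i => Finset.mem_Icc.1 (ha.1 i)⟩
  have hrem : ∀ a (ha : a ∈ interlacing l.parts),
      ofStrictAnti a (hmem a ha).1 ∈ l.removals := by
    intro a ha
    rw [mem_removals, isBorderStrip_iff]
    intro i
    rw [ofStrictAnti_getD]
    split_ifs with hi
    · exact (hmem a ha).2 ⟨i, hi⟩
    · rw [List.getD_eq_default l.parts _ (by omega : l.parts.length ≤ i + 1)]
      exact ⟨le_rfl, Nat.zero_le _⟩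
  refine Finset.sum_bij (fun a ha => ofStrictAnti a (hmem a ha).1) hrem ?_ ?_
    fun a ha => hfg a _ (hrem a ha)
  · intro a ha b hb hab
    funext i
    have h := congrArg (fun m => m.parts.getD i 0) hab
    simpa only [ofStrictAnti_getD, Fin.is_lt, dite_true] using h
  · intro m hm
    rw [mem_removals, isBorderStrip_iff] at hm
    have hanti : StrictAnti fun i : Fin l.parts.length => m.parts.getD i 0 := by
      intro i j hij
      -- Padding by `0` keeps the sequence strict: `m_i ≥ l_{i+1} > 0` for all rows but the last, so
      -- at most one `0` occurs.
      have h1 := l.getD_pos (i := i + 1) (by have := j.2; have : (i : ℕ) < j := hij; omega)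
      have h2 := m.getD_succ_lt (i := i) (h1.trans_le (hm i).1)
      exact (getD_antitone m.decreasing (show (i : ℕ) + 1 ≤ j from hij)).trans_lt h2
    refine ⟨fun i => m.parts.getD i 0, ?_, ?_⟩
    · rw [interlacing, Finset.mem_filter, Fintype.mem_piFinset]
      exact ⟨fun i => Finset.mem_Icc.2 (hm i), hanti⟩
    · refine ext_getD fun i => ?_
      rw [ofStrictAnti_getD]
      split_ifs with hi
      · rfl
      · have h := (hm i).2
        rw [List.getD_eq_default l.parts _ (by omega)] at h
        omega

/-- The pseudo-pfaffians of the Chern series `c (1 + (d - u) t) / (1 - u t)`, as a sum over border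
strips. -/
theorem pf_twist_eq_sum (z u d : R) (hd : d * (d - 2 * u - z) = 0) (c : ℕ → R) (h0 : c 0 = 1)
    (h : ∀ p, 0 < p → pfTwo z c c p p = 0) (l : StrictPartition) :
    pf z (twist u d c) l.parts = ∑ m ∈ l.removals, (d - u) ^ hLines (l.skew m) *
      u ^ vLines (l.skew m) * d ^ numComponents (l.skew m) * pf z c m.parts := by
  rw [pf_twist z u d hd c h0 h l.parts l.decreasing l.pos]
  refine sum_interlacing l _ _ fun a ha hm => ?_
  rw [← prod_rowWeight u d ((mem_removals _ _).1 hm), Finset.prod_range]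
  simp only [ofStrictAnti_getD, Fin.is_lt, dif_pos, Fin.eta]
  rfl

end StrictPartition

/-! ### Specialization to `s_0` and `∂_0`. -/

theorem hLines_empty : hLines ∅ = 0 := by simp [hLines]

theorem vLines_empty : vLines ∅ = 0 := by simp [vLines]

theorem numComponents_pos {S : Finset (ℕ × ℕ)} (hS : S.Nonempty) : 0 < numComponents S := by
  obtain ⟨b, hb⟩ := hS
  have : Finite (boxGraph.induce (S : Set (ℕ × ℕ))).ConnectedComponent :=
    Finite.of_surjective _ (Quot.mk_surjective)
  exact Nat.card_pos_iff.2
    ⟨⟨(boxGraph.induce (S : Set (ℕ × ℕ))).connectedComponentMk ⟨b, hb⟩⟩, this⟩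

theorem inc_Q (m : StrictPartition) : inc (Q m) = pf z c m.parts := map_pf inc _ _ _

theorem s0_inc_Q (l : StrictPartition) : s0 (inc (Q l)) =
    ∑ m ∈ l.removals, x 1 ^ hLines (l.skew m) * (x 1 - z) ^ vLines (l.skew m) *
      (2 * x 1 - z) ^ numComponents (l.skew m) * inc (Q m) := by
  have h := StrictPartition.pf_twist_eq_sum z (x 1 - z) (2 * x 1 - z) (by ring) c c_zero c_rel l
  have hc : (fun k => s0 (c k)) = twist (x 1 - z) (2 * x 1 - z) c := funext s0_c
  rw [inc_Q, map_pf, s0_z, hc, h, show 2 * x 1 - z - (x 1 - z) = x 1 by ring]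
  simp only [inc_Q]

theorem numComponents_empty : numComponents ∅ = 0 := by
  have h := numComponents_add (S := ∅) (by simp)
  simp only [Finset.card_empty] at h
  omega

/-- After multiplication by `ε`, the relation `ε² = (z - 2 x_1) ε` lets `-ε` act as `2 x_1 - z`, so
`d - u` acts as `x_1`. -/
theorem neg_eps_mul_pow_left (n : ℕ) :
    -eps * (-eps - toDual (x 1 - z)) ^ n = -eps * toDual (x 1 ^ n) := by
  induction n with
  | zero => simp
  | succ n ih =>
    have h := eps_sq
    simp only [map_sub, map_mul, map_ofNat, map_pow] at h ih ⊢
    rw [pow_succ, pow_succ]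
    linear_combination (-eps - (toDual (x 1) - toDual z)) * ih + toDual (x 1) ^ n * h

theorem neg_eps_pow_succ (n : ℕ) : (-eps) ^ (n + 1) = -eps * toDual ((2 * x 1 - z) ^ n) := by
  induction n with
  | zero => simp
  | succ n ih =>
    have h := eps_sq
    simp only [map_sub, map_mul, map_ofNat, map_pow] at h ih ⊢
    rw [pow_succ, ih, pow_succ (2 * toDual (x 1) - toDual z) n]
    linear_combination (2 * toDual (x 1) - toDual z) ^ n * h

theorem im_neg_eps_mul (f : GamXY) : (-eps * toDual f).im = -f := by
  simp [eps, QuadraticAlgebra.algebraMap_re, QuadraticAlgebra.algebraMap_im]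

theorem im_toDual (f : GamXY) : (toDual f).im = 0 := by
  simp [QuadraticAlgebra.algebraMap_im]

theorem del0Hom_inc_Q (l : StrictPartition) : del0Hom (inc (Q l)) =
    ∑ m ∈ l.removals, (-eps - toDual (x 1 - z)) ^ hLines (l.skew m) *
      toDual (x 1 - z) ^ vLines (l.skew m) * (-eps) ^ numComponents (l.skew m) *
      toDual (inc (Q m)) := by
  have h := StrictPartition.pf_twist_eq_sum (toDual z) (toDual (x 1 - z)) (-eps) (by
      have h := eps_sq
      simp only [map_sub, map_mul, map_ofNat] at h ⊢
      linear_combination h) (fun k => toDual (c k)) (by rw [c_zero, map_one])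
    (fun p hp => by rw [← map_pfTwo, c_rel p hp, map_zero]) l
  have hc : (fun k => del0Hom (c k)) = twist (toDual (x 1 - z)) (-eps) fun k => toDual (c k) :=
    funext del0Hom_c
  rw [inc_Q, map_pf, del0Hom_z, hc, h]
  simp only [inc_Q, map_pf]

theorem del0_inc_Q (l : StrictPartition) : del0 (inc (Q l)) =
    ∑ m ∈ l.removals with (l.skew m).Nonempty, x 1 ^ hLines (l.skew m) *
      (x 1 - z) ^ vLines (l.skew m) * (2 * x 1 - z) ^ (numComponents (l.skew m) - 1) *
      inc (Q m) := by
  -- Writing the coefficient of `ε` as a linear coordinate lets it pass through the sum.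
  have him : ∀ w : Dual, -w.im = -QuadraticAlgebra.linearEquivTuple 0 (z - 2 * x 1) w 1 := by
    intro w
    simp
  rw [del0, del0Hom_inc_Q, him, map_sum, Finset.sum_apply, ← Finset.sum_neg_distrib,
    Finset.sum_filter]
  refine Finset.sum_congr rfl fun m _ => ?_
  rw [← him]
  split_ifs with hne
  -- A nonempty strip has a component, hence a factor `-ε`; this factor turns the other `-ε` into `2
  -- x_1 - z` and is itself the one component missing from the exponent.
  · have h : (-eps - toDual (x 1 - z)) ^ hLines (l.skew m) *
        toDual (x 1 - z) ^ vLines (l.skew m) * (-eps) ^ numComponents (l.skew m) *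
        toDual (inc (Q m)) = -eps * toDual (x 1 ^ hLines (l.skew m) *
          (x 1 - z) ^ vLines (l.skew m) * (2 * x 1 - z) ^ (numComponents (l.skew m) - 1) *
          inc (Q m)) := by
      obtain ⟨k, hk⟩ := Nat.exists_eq_succ_of_ne_zero (numComponents_pos hne).ne'
      have h1 := neg_eps_mul_pow_left (hLines (l.skew m))
      rw [hk, neg_eps_pow_succ, Nat.succ_sub_one]
      simp only [map_mul, map_pow] at h1 ⊢
      linear_combination (toDual (x 1 - z) ^ vLines (l.skew m) * toDual (2 * x 1 - z) ^ k *
        toDual (inc (Q m))) * h1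
    rw [h, im_neg_eps_mul, neg_neg]
  -- The empty strip gives a term without `ε`, so it drops out of `∂_0`.
  · rw [Finset.not_nonempty_iff_eq_empty.1 hne, hLines_empty, vLines_empty, numComponents_empty,
      pow_zero, pow_zero, pow_zero, one_mul, one_mul, one_mul, im_toDual, neg_zero]

end TypeC

theorem mainTheorem12 (l : TypeC.StrictPartition) :
    TypeC.s0 (TypeC.inc (TypeC.Q l)) =
      ∑ m ∈ l.removals,
        TypeC.x 1 ^ TypeC.hLines (l.skew m) *
          (TypeC.x 1 - TypeC.z) ^ TypeC.vLines (l.skew m) *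
          (2 * TypeC.x 1 - TypeC.z) ^ TypeC.numComponents (l.skew m) *
          TypeC.inc (TypeC.Q m) ∧
    TypeC.del0 (TypeC.inc (TypeC.Q l)) =
      ∑ m ∈ l.removals with (l.skew m).Nonempty,
        TypeC.x 1 ^ TypeC.hLines (l.skew m) *
          (TypeC.x 1 - TypeC.z) ^ TypeC.vLines (l.skew m) *
          (2 * TypeC.x 1 - TypeC.z) ^ (TypeC.numComponents (l.skew m) - 1) *
          TypeC.inc (TypeC.Q m) :=
  ⟨TypeC.s0_inc_Q l, TypeC.del0_inc_Q l⟩
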